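/- Let $\lambda>0$ and $v\in\mathbb R^2$. For a symmetric matrix $\xi\in\mathbb R^{2\times 2}_{\mathrm{sym}}$ let $$S(v,\xi)=\mathbf g(v)^{-1/2}\,\frac{\xi}{\sqrt{1+|v|^2}}\,\mathbf g(v)^{-1/2},\qquad \mathbf g(v)=\mathrm{Id}_{2\times 2}+v\otimes v .$$ For a $2\times2$ matrix $A$ let $|A|$ be its Frobenius norm, and set $F_\lambda(A)=0$ if $A=0$ and $F_\lambda(A)=|A|^2+\lambda$ otherwise; for symmetric $A$ let $\rho^0(A)$ be the sum of the absolute values of the two eigenvalues of $A$, counted with multiplicity. Let $$f_\lambda(v,\xi)=\lambda^{-1/2}F_\lambda(S(v,\xi))\sqrt{1+|v|^2},$$ and let $$Q_2f_\lambda(v,\xi)=\inf\Big\{\int_{Q}f_\lambda(v,\xi+\nabla^2\varphi(x))\,dx:\ \varphi\in W^{2,\infty}_0(Q)\Big\},\qquad Q=[-1/2,1/2]^2,$$ be the 2-quasiconvexification of $f_\lambda(v,\cdot)$, where $W^{2,\infty}_0(Q)=W^{2,\infty}(Q)\cap W^{2,1}_0(Q)$ and $W^{2,1}_0(Q)$ is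 the closure in $W^{2,1}$ of the smooth functions with compact support in the interior of $Q$. Then all these integrals exist and are finite, and for every $\xi\in\mathbb R^{2\times 2}_{\mathrm{sym}}$ $$Q_2f_\lambda(v,\xi)=\sqrt{1+|v|^2}\begin{cases}2\rho^0(S(v,\xi))-2\,\dfrac{|\det S(v,\xi)|}{\sqrt\lambda}&\text{if }\rho^0(S(v,\xi))\le\sqrt\lambda,\\[2mm]\dfrac{|S(v,\xi)|^2}{\sqrt\lambda}+\sqrt\lambda&\text{otherwise.}\end{cases}$$ -/

import Mathlib

open MeasureTheory Filter Topology
open scoped ENNReal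

noncomputable section

namespace WillmoreGraph

/-- The plane `ℝ²` with its Euclidean norm. -/
abbrev Plane : Type := EuclideanSpace ℝ (Fin 2)

/-- Real `2 × 2` matrices. -/
abbrev Mat : Type := Matrix (Fin 2) (Fin 2) ℝ

/-! ### The integrand -/

/-- `g(v) = id + v ⊗ v`. -/
def metric (v : Plane) : Mat := 1 + Matrix.of fun i j => v i * v j

/-- `g(v)^{-1/2}`, by the functional calculus of symmetric matrices. -/
def metricInvSqrt (v : Plane) : Mat := cfc (fun t : ℝ => t ^ (-(1 / 2) : ℝ)) (metric v)

/-- `II(v, ξ) = ξ / √(1 + |v|²)`. -/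
def secondForm (v : Plane) (ξ : Mat) : Mat := (1 / √(1 + ‖v‖ ^ 2)) • ξ

/-- `S(v, ξ) = g(v)^{-1/2} II(v, ξ) g(v)^{-1/2}`. -/
def shape (v : Plane) (ξ : Mat) : Mat := metricInvSqrt v * secondForm v ξ * metricInvSqrt v

/-- `|A|²`, the square of the Frobenius (Euclidean) norm. -/
def frobSq (A : Mat) : ℝ := ∑ i, ∑ j, A i j ^ 2

/-- `ρ⁰(A)`: the sum of the absolute values of the eigenvalues, counted with multiplicity,
of a symmetric matrix. -/
def rho (A : Mat) (hA : A.IsHermitian) : ℝ := ∑ i, |hA.eigenvalues i|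

/-- `F_λ(A) = 0` if `A = 0` and `|A|² + λ` otherwise. -/
def bigF (lam : ℝ) (A : Mat) : ℝ := if A = 0 then 0 else frobSq A + lam

/-- `f_λ(v, ξ) = λ^{-1/2} F_λ(S(v, ξ)) √(1 + |v|²)`. -/
def integrand (lam : ℝ) (v : Plane) (ξ : Mat) : ℝ :=
  lam ^ (-(1 / 2) : ℝ) * bigF lam (shape v ξ) * √(1 + ‖v‖ ^ 2)

/-- `S(v, ξ)` is symmetric when `ξ` is, so that `ρ⁰(S(v, ξ))` makes sense. -/
theorem shape_isHermitian (v : Plane) {ξ : Mat} (hξ : ξ.IsSymm) : (shape v ξ).IsHermitian := by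
  have hP : (metricInvSqrt v).conjTranspose = metricInvSqrt v := by
    have h : IsSelfAdjoint (metricInvSqrt v) := cfc_predicate _ _
    exact h
  have hξ' : (secondForm v ξ).conjTranspose = secondForm v ξ := by
    rw [secondForm, Matrix.conjTranspose_smul, Matrix.conjTranspose_eq_transpose_of_trivial,
      hξ.eq, star_trivial]
  rw [Matrix.IsHermitian, shape, Matrix.conjTranspose_mul, Matrix.conjTranspose_mul, hP, hξ',
    Matrix.mul_assoc]

/-! ### Second order Sobolev functions on the unit square -/

/-- The square `Q = [-1/2, 1/2]²`. -/
def square : Set Plane := {x | ∀ i, x i ∈ Set.Icc (-(1 / 2) : ℝ) (1 / 2)}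

/-- The interior of `Q`, as an open set. -/
def squareInterior : TopologicalSpace.Opens Plane := ⟨interior square, isOpen_interior⟩

/-- Smooth real functions with compact support in the interior of `Q`. -/
abbrev Test : Type := TestFunction squareInterior ℝ (⊤ : ℕ∞)

/-- The `i`-th classical partial derivative. -/
def partialD (i : Fin 2) (u : Plane → ℝ) (x : Plane) : ℝ :=
  fderiv ℝ u x (EuclideanSpace.single i 1)

/-- `w` is the weak `i`-th partial derivative of `u` in the interior of `Q`. -/
def IsWeakPartial (i : Fin 2) (u w : Plane → ℝ) : Prop :=
  ∀ ψ : Test, ∫ x in interior square, u x * partialD i ψ x = -∫ x in interior square, w x * ψ x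

/-- `φ ∈ W^{2,∞}(Q)`, with weak gradient `G` and weak Hessian `H`. -/
structure IsW2Infty (φ : Plane → ℝ) (G : Fin 2 → Plane → ℝ) (H : Plane → Mat) : Prop where
  bounded : MemLp φ ∞ (volume.restrict square)
  bounded_grad : ∀ i, MemLp (G i) ∞ (volume.restrict square)
  bounded_hess : ∀ i j, MemLp (fun x => H x i j) ∞ (volume.restrict square)
  grad : ∀ i, IsWeakPartial i φ (G i)
  hess : ∀ i j, IsWeakPartial j (G i) (fun x => H x i j)

/-- `φ`, with gradient `G` and Hessian `H`, belongs to `W^{2,1}_0(Q)`, the closure of the test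
functions in the norm of `W^{2,1}(Q)`. -/
def IsInW21Zero (φ : Plane → ℝ) (G : Fin 2 → Plane → ℝ) (H : Plane → Mat) : Prop :=
  ∃ ψ : ℕ → Test,
    Tendsto (fun n => eLpNorm (fun x => φ x - ψ n x) 1 (volume.restrict square)) atTop (𝓝 0) ∧
    (∀ i, Tendsto (fun n => eLpNorm (fun x => G i x - partialD i (ψ n) x) 1
      (volume.restrict square)) atTop (𝓝 0)) ∧
    ∀ i j, Tendsto (fun n => eLpNorm (fun x => H x i j - partialD j (partialD i (ψ n)) x) 1
      (volume.restrict square)) atTop (𝓝 0)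

/-- `φ ∈ W^{2,∞}_0(Q) = W^{2,∞}(Q) ∩ W^{2,1}_0(Q)`, with weak gradient `G` and weak
Hessian `H`. -/
def IsW2InftyZero (φ : Plane → ℝ) (G : Fin 2 → Plane → ℝ) (H : Plane → Mat) : Prop :=
  IsW2Infty φ G H ∧ IsInW21Zero φ G H

/-- The 2-quasiconvexification
`Q₂f(ξ) = inf {∫_Q f(ξ + ∇²φ) dx : φ ∈ W^{2,∞}_0(Q)}`, as an infimum in `[-∞, ∞]`. -/
def quasiconvexification (f : Mat → ℝ) (ξ : Mat) : EReal :=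
  ⨅ (φ : Plane → ℝ) (G : Fin 2 → Plane → ℝ) (H : Plane → Mat) (_ : IsW2InftyZero φ G H),
    ((∫ x in square, f (ξ + H x) : ℝ) : EReal)

end WillmoreGraph

end

noncomputable section

namespace WillmoreGraph

open scoped Manifold

/-! ### One-dimensional oscillating profiles -/

/-! After a congruence `X ↦ N X Nᵀ` that makes the shape operator at `ξ` equal to `diag(a, b)`, only
the relaxation of `F_λ` is at stake; its value is `relaxed lam a b`.

Lower bound: for signs `σ`, `τ` and `m ≥ √λ`, `minorant` is an affine function plus a multiple of
the determinant. For symmetric `X ≠ 0`, `F_λ - minorant = (σ X₀₀ + τ X₁₁ - m)² + 2 (1 - σ τ) X₀₁² ≥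
0`, and at `X = 0` the gap is `m² - λ ≥ 0`. Entries and determinant of a Hessian in `W^{2,∞}_0` have
mean zero (`integral_hess_eq_zero`, `integral_det_hess_eq_zero`), so the integral of the minorant is
its value at `ξ`. Taking the signs of `a`, `b` and `m = max (|a| + |b|) √λ` gives the formula.

Upper bound: if `|a| + |b| > √λ`, the minorant touches `F_λ` at `diag(a, b)` itself and `φ = 0` is
optimal. Otherwise a second order laminate (`exists_second_order_laminate`) keeps the transformed
Hessian, off a small set, in three diagonal matrices where `F_λ` equals the minorant with `m = √λ`.
The integral of that minorant is again known exactly, so no volume fractions are computed. -/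

/-- A smooth `1`-periodic approximation of the indicator of `{cos (2πx) ≥ cos (πθ)}` with
transition layers controlled by `δ`. -/
def layer (θ δ c x : ℝ) : ℝ :=
  Real.smoothTransition ((Real.cos (2 * Real.pi * x) - Real.cos (Real.pi * θ)) / δ + c)

theorem layer_nonneg (θ δ c x : ℝ) : 0 ≤ layer θ δ c x := Real.smoothTransition.nonneg _

theorem layer_le_one (θ δ c x : ℝ) : layer θ δ c x ≤ 1 := Real.smoothTransition.le_one _

theorem contDiff_layer (θ δ c : ℝ) : ContDiff ℝ (⊤ : ℕ∞) (layer θ δ c) := by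
  unfold layer
  refine Real.smoothTransition.contDiff.comp ?_
  have : ContDiff ℝ (⊤ : ℕ∞) Real.cos := Real.contDiff_cos
  fun_prop

theorem periodic_layer (θ δ c : ℝ) : Function.Periodic (layer θ δ c) 1 := by
  intro x
  unfold layer
  rw [show 2 * Real.pi * (x + 1) = 2 * Real.pi * x + 2 * Real.pi by ring, Real.cos_add_two_pi]

/-- The mean of the layer function can be prescribed. -/
theorem exists_integral_layer_eq {θ δ : ℝ} (h0 : 0 < θ) (h1 : θ < 1) (hδ : 0 < δ) :
    ∃ c ∈ Set.Icc (0 : ℝ) 1, ∫ x in (-(1 / 2) : ℝ)..(1 / 2), layer θ δ c x = θ := by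
  have hcont : Continuous fun c : ℝ => ∫ x in (-(1 / 2) : ℝ)..(1 / 2), layer θ δ c x := by
    apply intervalIntegral.continuous_parametric_intervalIntegral_of_continuous'
    unfold Function.uncurry layer
    refine Real.smoothTransition.continuous.comp ?_
    fun_prop
  have hint : ∀ c a b, IntervalIntegrable (layer θ δ c) volume a b := fun c a b =>
    (contDiff_layer θ δ c).continuous.intervalIntegrable a b
  have hsplit : ∀ c, ∫ x in (-(1 / 2) : ℝ)..(1 / 2), layer θ δ c x =
      (∫ x in (-(1 / 2) : ℝ)..(-(θ / 2)), layer θ δ c x) +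
      (∫ x in (-(θ / 2))..(θ / 2), layer θ δ c x) + ∫ x in (θ / 2)..(1 / 2), layer θ δ c x := by
    intro c
    rw [intervalIntegral.integral_add_adjacent_intervals (hint _ _ _) (hint _ _ _),
      intervalIntegral.integral_add_adjacent_intervals (hint _ _ _) (hint _ _ _)]
  have hπ := Real.pi_pos
  have hout : ∀ x : ℝ, θ / 2 ≤ |x| → |x| ≤ 1 / 2 →
      Real.cos (2 * Real.pi * x) ≤ Real.cos (Real.pi * θ) := by
    intro x hx hx'
    rw [← Real.cos_abs (2 * Real.pi * x), abs_mul, abs_of_pos (by positivity : 0 < 2 * Real.pi)]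
    apply Real.cos_le_cos_of_nonneg_of_le_pi <;> nlinarith
  have hin : ∀ x : ℝ, |x| ≤ θ / 2 →
      Real.cos (Real.pi * θ) ≤ Real.cos (2 * Real.pi * x) := by
    intro x hx
    rw [← Real.cos_abs (2 * Real.pi * x), abs_mul, abs_of_pos (by positivity : 0 < 2 * Real.pi)]
    apply Real.cos_le_cos_of_nonneg_of_le_pi
    · positivity
    · nlinarith
    · nlinarith
  -- In `[-1/2, 1/2]` the set `cos (2πx) ≥ cos (πθ)` is `|x| ≤ θ/2`. At `c = 0` the layer vanishes
  -- outside it, at `c = 1` it equals one on it; the mean is continuous in `c`.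
  have hlow : ∫ x in (-(1 / 2) : ℝ)..(1 / 2), layer θ δ 0 x ≤ θ := by
    have hz : ∀ x : ℝ, θ / 2 ≤ |x| → |x| ≤ 1 / 2 → layer θ δ 0 x = 0 := by
      intro x hx hx'
      refine Real.smoothTransition.zero_of_nonpos ?_
      have := hout x hx hx'
      have := div_nonpos_of_nonpos_of_nonneg (sub_nonpos.2 this) hδ.le
      linarith
    rw [hsplit, intervalIntegral.integral_congr (g := fun _ => (0 : ℝ)) (a := -(1 / 2)),
      intervalIntegral.integral_congr (g := fun _ => (0 : ℝ)) (b := 1 / 2)]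
    · have : ∫ x in (-(θ / 2))..(θ / 2), layer θ δ 0 x ≤ ∫ x in (-(θ / 2))..(θ / 2), (1 : ℝ) :=
        intervalIntegral.integral_mono (by linarith) (hint _ _ _) (by simp)
          (fun x => layer_le_one _ _ _ x)
      simp only [intervalIntegral.integral_const, smul_eq_mul, mul_zero, mul_one] at this ⊢
      linarith
    · intro x hx
      rw [Set.uIcc_of_le (by linarith)] at hx
      exact hz x ((le_abs_self x).trans' hx.1) (abs_le.2 ⟨by linarith [hx.1], hx.2⟩)
    · intro x hx
      rw [Set.uIcc_of_le (by linarith)] at hx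
      exact hz x ((neg_le_abs x).trans' (by linarith [hx.2])) (abs_le.2 ⟨hx.1, by linarith [hx.2]⟩)
  have hhigh : θ ≤ ∫ x in (-(1 / 2) : ℝ)..(1 / 2), layer θ δ 1 x := by
    have hnn : ∀ a b : ℝ, a ≤ b → 0 ≤ ∫ x in a..b, layer θ δ 1 x := fun a b hab =>
      intervalIntegral.integral_nonneg hab fun x _ => layer_nonneg _ _ _ x
    have hmid : ∫ x in (-(θ / 2))..(θ / 2), layer θ δ 1 x = θ := by
      rw [intervalIntegral.integral_congr (g := fun _ => (1 : ℝ))]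
      · simp
      · intro x hx
        rw [Set.uIcc_of_le (by linarith)] at hx
        refine Real.smoothTransition.one_of_one_le ?_
        have := hin x (abs_le.2 hx)
        have := div_nonneg (sub_nonneg.2 this) hδ.le
        linarith
    rw [hsplit, hmid]
    have := hnn (-(1 / 2)) (-(θ / 2)) (by linarith)
    have := hnn (θ / 2) (1 / 2) (by linarith)
    linarith
  exact intermediate_value_Icc zero_le_one hcont.continuousOn ⟨hlow, hhigh⟩

/-- A smooth function is the derivative of a smooth function vanishing at the origin. -/
theorem exists_contDiff_primitive {g : ℝ → ℝ} (hg : ContDiff ℝ (⊤ : ℕ∞) g) :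
    ∃ G : ℝ → ℝ, ContDiff ℝ (⊤ : ℕ∞) G ∧ (∀ x, HasDerivAt G (g x) x) ∧
      ∀ x, G x = ∫ t in (0 : ℝ)..x, g t := by
  have hd : ∀ x, HasDerivAt (fun x => ∫ t in (0 : ℝ)..x, g t) (g x) x := fun x =>
    hg.continuous.integral_hasStrictDerivAt 0 x |>.hasDerivAt
  refine ⟨_, ?_, hd, fun _ => rfl⟩
  rw [contDiff_infty_iff_deriv]
  refine ⟨fun x => (hd x).differentiableAt, ?_⟩
  rwa [show deriv (fun x => ∫ t in (0 : ℝ)..x, g t) = g from funext fun x => (hd x).deriv]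

/-- Shrinking transition layers of the profile intersect in such a level set; countability makes it
null for every measure without atoms. -/
theorem countable_cos_eq (a c : ℝ) (ha : a ≠ 0) :
    {x : ℝ | Real.cos (a * x) = Real.cos c}.Countable := by
  have : {x : ℝ | Real.cos (a * x) = Real.cos c} ⊆
      (Set.range fun k : ℤ => (2 * k * Real.pi + c) / a) ∪
      Set.range fun k : ℤ => (2 * k * Real.pi - c) / a := by
    intro x hx
    obtain ⟨k, hk | hk⟩ := Real.cos_eq_cos_iff.1 hx.symm
    · left; exact ⟨k, by field_simp; linarith⟩
    · right; exact ⟨k, by field_simp; linarith⟩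
  exact ((Set.countable_range _).union (Set.countable_range _)).mono this

/-- The primitive of a `1`-periodic function of mean zero is bounded. -/
theorem abs_primitive_le_of_periodic {g G : ℝ → ℝ} {M : ℝ} (hgc : Continuous g)
    (hG : ∀ x, G x = ∫ t in (0 : ℝ)..x, g t) (hM : ∀ x, |g x| ≤ M)
    (hp : Function.Periodic g 1) (h0 : ∫ t in (-(1 / 2) : ℝ)..(1 / 2), g t = 0) (x : ℝ) :
    |G x| ≤ M := by
  have hper : Function.Periodic G 1 := by
    intro y
    rw [hG, hG, ← intervalIntegral.integral_add_adjacent_intervals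
      (hgc.intervalIntegrable 0 y) (hgc.intervalIntegrable y (y + 1)),
      hp.intervalIntegral_add_eq y (-(1 / 2)), show (-(1 / 2) : ℝ) + 1 = 1 / 2 by norm_num, h0,
      add_zero]
  have hM0 : 0 ≤ M := (abs_nonneg _).trans (hM 0)
  obtain ⟨y, hy, hxy⟩ := hper.exists_mem_Ico₀ one_pos x
  rw [hxy, hG]
  have := intervalIntegral.norm_integral_le_of_norm_le_const (a := 0) (b := y) (f := g) (C := M)
    fun t _ => hM t
  rw [Real.norm_eq_abs, sub_zero, abs_of_nonneg hy.1] at this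
  nlinarith [hy.2]

/-- A smooth function with small value and small slope whose second derivative takes only the
values `s` and `t` up to a set of small measure, with a smooth cut-off that separates the two
phases. -/
theorem exists_profile (ν : Measure ℝ) [IsFiniteMeasure ν] [NullSingletonClass ν] {s t : ℝ}
    (hst : s * t ≤ 0) (R : ℝ) {κ : ℝ} (hκ : 0 < κ) :
    ∃ (w w' w'' χ : ℝ → ℝ) (B : Set ℝ), ContDiff ℝ (⊤ : ℕ∞) w ∧ ContDiff ℝ (⊤ : ℕ∞) χ ∧
      (∀ x, HasDerivAt w (w' x) x) ∧ (∀ x, HasDerivAt w' (w'' x) x) ∧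
      (∀ x, χ x ∈ Set.Icc (0 : ℝ) 1) ∧ (∀ x, |w'' x| ≤ |s| + |t|) ∧ (∀ x, |w' x| ≤ κ) ∧
      (∀ x, |x| ≤ R → |w x| ≤ κ) ∧ MeasurableSet B ∧ ν B ≤ ENNReal.ofReal κ ∧
      ∀ x ∉ B, (w'' x = s ∧ ∀ᶠ y in 𝓝 x, χ y = 0) ∨ (w'' x = t ∧ ∀ᶠ y in 𝓝 x, χ y = 1) := by
  -- If `s` or `t` vanishes, `w = 0` is already in a single phase and a constant `χ` selects it.
  rcases hst.eq_or_lt with h | hlt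
  · have hz : ∀ χ₀ : ℝ, χ₀ ∈ Set.Icc (0 : ℝ) 1 → ((0 = s ∧ 0 = χ₀) ∨ (0 = t ∧ χ₀ = 1)) →
      ∃ (w w' w'' χ : ℝ → ℝ) (B : Set ℝ), ContDiff ℝ (⊤ : ℕ∞) w ∧ ContDiff ℝ (⊤ : ℕ∞) χ ∧
      (∀ x, HasDerivAt w (w' x) x) ∧ (∀ x, HasDerivAt w' (w'' x) x) ∧
      (∀ x, χ x ∈ Set.Icc (0 : ℝ) 1) ∧ (∀ x, |w'' x| ≤ |s| + |t|) ∧ (∀ x, |w' x| ≤ κ) ∧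
      (∀ x, |x| ≤ R → |w x| ≤ κ) ∧ MeasurableSet B ∧ ν B ≤ ENNReal.ofReal κ ∧
      ∀ x ∉ B, (w'' x = s ∧ ∀ᶠ y in 𝓝 x, χ y = 0) ∨ (w'' x = t ∧ ∀ᶠ y in 𝓝 x, χ y = 1) := by
      intro χ₀ hχ₀ hc
      refine ⟨fun _ => 0, fun _ => 0, fun _ => 0, fun _ => χ₀, ∅, contDiff_const, contDiff_const,
        fun x => hasDerivAt_const _ _, fun x => hasDerivAt_const _ _, fun _ => hχ₀,
        fun x => ?_, fun x => ?_, fun x _ => ?_, MeasurableSet.empty, by simp, fun x _ => ?_⟩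
      · rw [abs_zero]; positivity
      · rw [abs_zero]; positivity
      · rw [abs_zero]; positivity
      · rcases hc with hc | hc
        · exact Or.inl ⟨hc.1, by simp [← hc.2]⟩
        · exact Or.inr ⟨hc.1, by simp [hc.2]⟩
    rcases mul_eq_zero.1 h with h | h
    · exact hz 0 (by simp) (Or.inl ⟨h.symm, rfl⟩)
    · exact hz 1 (by simp) (Or.inr ⟨h.symm, rfl⟩)
  have hts : t - s ≠ 0 := by
    intro h
    rw [sub_eq_zero.1 h] at hlt
    nlinarith [mul_self_nonneg s]
  -- The volume fraction of the phase `s` for which `θ s + (1 - θ) t = 0`, so that `w'` can be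
  -- periodic.
  set θ := t / (t - s) with hθ
  have hθ01 : 0 < θ ∧ θ < 1 := by
    rcases mul_neg_iff.1 hlt with ⟨h1, h2⟩ | ⟨h1, h2⟩
    · exact ⟨div_pos_of_neg_of_neg h2 (by linarith),
        (div_lt_one_of_neg (by linarith)).2 (by linarith)⟩
    · exact ⟨div_pos h2 (by linarith), (div_lt_one (by linarith)).2 (by linarith)⟩
  set M := |s| + |t| with hM
  have hM0 : 0 ≤ M := by positivity
  -- The period: `w'` has size at most `ε M`, and `w` at most `ε M |R|` on `|x| ≤ R`.
  set ε := κ / ((M + 1) * (|R| + 1)) with hε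
  have hε0 : 0 < ε := by positivity
  have hεM : ε * M ≤ κ := by
    rw [hε, div_mul_eq_mul_div, div_le_iff₀ (by positivity)]
    apply mul_le_mul_of_nonneg_left _ hκ.le
    nlinarith [abs_nonneg R]
  have hεMR : ε * M * |R| ≤ κ := by
    rw [hε, div_mul_eq_mul_div, div_mul_eq_mul_div, div_le_iff₀ (by positivity), mul_assoc]
    apply mul_le_mul_of_nonneg_left _ hκ.le
    nlinarith [abs_nonneg R]
  set c₀ := Real.cos (Real.pi * θ) with hc₀
  have ha : 2 * Real.pi / ε ≠ 0 := by positivity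
  -- the transition layers have small measure
  obtain ⟨δ, hδ, hBδ⟩ : ∃ δ > 0, ν {x | Real.cos (2 * Real.pi / ε * x) ∈
      Set.Icc (c₀ - 2 * δ) (c₀ + δ)} ≤ ENNReal.ofReal κ := by
    let B : ℕ → Set ℝ := fun n => {x | Real.cos (2 * Real.pi / ε * x) ∈
      Set.Icc (c₀ - 2 * (1 / ((n : ℝ) + 1))) (c₀ + 1 / ((n : ℝ) + 1))}
    have hBm : ∀ n, MeasurableSet (B n) := fun n =>
      measurableSet_Icc.preimage (by fun_prop)
    have hanti : Antitone B := by
      intro m n hmn x hx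
      have := one_div_le_one_div_of_le (by positivity : (0 : ℝ) < m + 1)
        (by exact_mod_cast Nat.succ_le_succ hmn : (m : ℝ) + 1 ≤ n + 1)
      exact ⟨by linarith [hx.1], by linarith [hx.2]⟩
    have hlim := tendsto_measure_iInter_atTop (μ := ν)
      (fun n => (hBm n).nullMeasurableSet) hanti ⟨0, measure_ne_top _ _⟩
    have hzero : ν (⋂ n, B n) = 0 := by
      refine measure_mono_null ?_ ((countable_cos_eq _ (Real.pi * θ) ha).measure_zero ν)
      intro x hx
      rw [Set.mem_iInter] at hx
      have h1 := tendsto_one_div_add_atTop_nhds_zero_nat (𝕜 := ℝ)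
      refine le_antisymm ?_ ?_
      · refine ge_of_tendsto' (f := fun n : ℕ => c₀ + 1 / ((n : ℝ) + 1)) (x := atTop) ?_
          fun n => (hx n).2
        simpa using h1.const_add c₀
      · refine le_of_tendsto' (f := fun n : ℕ => c₀ - 2 * (1 / ((n : ℝ) + 1))) (x := atTop) ?_
          fun n => (hx n).1
        simpa using (h1.const_mul 2).const_sub c₀
    rw [hzero] at hlim
    obtain ⟨n, hn⟩ := (hlim.eventually_le_const (ENNReal.ofReal_pos.2 hκ)).exists
    exact ⟨1 / ((n : ℝ) + 1), by positivity, hn⟩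
  -- The shift `c` depends on `δ`, but for every `c ∈ [0, 1]` the layer varies only where the cosine
  -- is within `δ` of `c₀`. The cut-off `χ` varies between `c₀ - 2δ` and `c₀ - δ`, inside the phase
  -- `t`. The window `[c₀ - 2δ, c₀ + δ]` covers both transitions.
  obtain ⟨c, hc, hmean⟩ := exists_integral_layer_eq hθ01.1 hθ01.2 hδ
  let g : ℝ → ℝ := fun x => t + (s - t) * layer θ δ c x
  have hg : ContDiff ℝ (⊤ : ℕ∞) g := contDiff_const.add (contDiff_const.mul (contDiff_layer _ _ _))
  have hgM : ∀ x, |g x| ≤ M := by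
    intro x
    have h1 := layer_nonneg θ δ c x
    have h2 := layer_le_one θ δ c x
    have : g x = (1 - layer θ δ c x) * t + layer θ δ c x * s := by simp only [g]; ring
    rw [this]
    refine (abs_add_le _ _).trans ?_
    rw [abs_mul, abs_mul, abs_of_nonneg h1, abs_of_nonneg (by linarith : 0 ≤ 1 - layer θ δ c x)]
    nlinarith [abs_nonneg s, abs_nonneg t]
  have hg0 : ∫ x in (-(1 / 2) : ℝ)..(1 / 2), g x = 0 := by
    simp only [g]
    rw [intervalIntegral.integral_add (by simp)
      (((contDiff_layer θ δ c).continuous.const_mul _).intervalIntegrable _ _),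
      intervalIntegral.integral_const_mul, hmean, hθ]
    simp only [intervalIntegral.integral_const, smul_eq_mul]
    field_simp
    ring
  obtain ⟨V, hVc, hVd, hV⟩ := exists_contDiff_primitive hg
  have hVM : ∀ x, |V x| ≤ M := abs_primitive_le_of_periodic hg.continuous hV hgM
    (fun x => by simp only [g, periodic_layer θ δ c x]) hg0
  obtain ⟨w, hwc, hwd, hw⟩ := exists_contDiff_primitive (g := fun x => ε * V (x / ε))
    (contDiff_const.mul (hVc.comp (contDiff_id.div_const ε)))
  have hw'M : ∀ x, |ε * V (x / ε)| ≤ ε * M := fun x => by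
    rw [abs_mul, abs_of_pos hε0]
    exact mul_le_mul_of_nonneg_left (hVM _) hε0.le
  have hcosc : Continuous fun x : ℝ => Real.cos (2 * Real.pi / ε * x) := by fun_prop
  have hcose : ∀ x : ℝ, Real.cos (2 * Real.pi * (x / ε)) = Real.cos (2 * Real.pi / ε * x) :=
    fun x => by congr 1; ring
  refine ⟨w, fun x => ε * V (x / ε), fun x => g (x / ε),
    fun x => Real.smoothTransition ((c₀ - δ - Real.cos (2 * Real.pi / ε * x)) / δ),
    {x | Real.cos (2 * Real.pi / ε * x) ∈ Set.Icc (c₀ - 2 * δ) (c₀ + δ)}, hwc, ?_, hwd, ?_,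
    fun x => ⟨Real.smoothTransition.nonneg _, Real.smoothTransition.le_one _⟩,
    fun x => hgM _, fun x => (hw'M x).trans hεM, ?_, measurableSet_Icc.preimage (by fun_prop),
    hBδ, ?_⟩
  · refine Real.smoothTransition.contDiff.comp ?_
    have : ContDiff ℝ (⊤ : ℕ∞) Real.cos := Real.contDiff_cos
    fun_prop
  · intro x
    have h := ((hVd (x / ε)).comp x ((hasDerivAt_id x).div_const ε)).const_mul ε
    rwa [show ε * (g (x / ε) * (1 / ε)) = g (x / ε) by field_simp] at h
  · intro x hx
    rw [hw]
    have := intervalIntegral.norm_integral_le_of_norm_le_const (a := 0) (b := x)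
      (f := fun x => ε * V (x / ε)) (C := ε * M) fun t _ => hw'M t
    rw [Real.norm_eq_abs, sub_zero] at this
    refine (this.trans ?_).trans hεMR
    exact mul_le_mul_of_nonneg_left (hx.trans (le_abs_self R)) (by positivity)
  · intro x hx
    by_cases hx1 : c₀ - 2 * δ ≤ Real.cos (2 * Real.pi / ε * x)
    · have hx2 : c₀ + δ < Real.cos (2 * Real.pi / ε * x) := by
        by_contra hcon
        exact hx ⟨hx1, not_lt.1 hcon⟩
      left
      constructor
      · have : layer θ δ c (x / ε) = 1 := by
          refine Real.smoothTransition.one_of_one_le ?_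
          rw [hcose]
          have : 1 ≤ (Real.cos (2 * Real.pi / ε * x) - c₀) / δ := by
            rw [le_div_iff₀ hδ]; linarith
          linarith [hc.1]
        simp only [g, this]
        ring
      · filter_upwards [hcosc.continuousAt.eventually_const_lt hx2] with y hy
        refine Real.smoothTransition.zero_of_nonpos ?_
        exact div_nonpos_of_nonpos_of_nonneg (by linarith) hδ.le
    · rw [not_le] at hx1
      right
      constructor
      · have : layer θ δ c (x / ε) = 0 := by
          refine Real.smoothTransition.zero_of_nonpos ?_
          rw [hcose]
          have : (Real.cos (2 * Real.pi / ε * x) - c₀) / δ ≤ -1 := by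
            rw [div_le_iff₀ hδ]; linarith
          linarith [hc.2]
        simp only [g, this]
        ring
      · filter_upwards [hcosc.continuousAt.eventually_lt_const hx1] with y hy
        refine Real.smoothTransition.one_of_one_le ?_
        rw [le_div_iff₀ hδ]
        linarith

/-! ### The unit square -/

theorem square_eq_preimage :
    square = (fun x : Plane => (x.ofLp : Fin 2 → ℝ)) ⁻¹'
      Set.Icc (fun _ => -(1 / 2)) (fun _ => 1 / 2) := by
  ext x
  simp only [square, Set.mem_ofPred_eq, Set.mem_preimage, Set.mem_Icc, Pi.le_def]
  exact forall_and

theorem volume_square : volume square = 1 := by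
  rw [square_eq_preimage, (PiLp.volume_preserving_ofLp (Fin 2)).measure_preimage
    measurableSet_Icc.nullMeasurableSet, Real.volume_Icc_pi]
  norm_num

instance : IsProbabilityMeasure (volume.restrict square) :=
  ⟨by rw [Measure.restrict_apply_univ, volume_square]⟩

theorem convex_square : Convex ℝ square := by
  rw [square_eq_preimage]
  exact (convex_Icc _ _).linear_preimage (WithLp.linearEquiv 2 ℝ (Fin 2 → ℝ)).toLinearMap

/-- A convex set has a null frontier. This reconciles weak derivatives, tested on the interior, with
norms taken over the closed square. -/
theorem restrict_interior_square : volume.restrict (interior square) = volume.restrict square := by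
  apply Measure.restrict_congr_set
  exact interior_ae_eq_of_null_frontier (convex_square.addHaar_frontier volume)

/-! ### Partial derivatives of smooth functions -/

theorem contDiff_partialD {u : Plane → ℝ} (hu : ContDiff ℝ (⊤ : ℕ∞) u) (i : Fin 2) :
    ContDiff ℝ (⊤ : ℕ∞) (partialD i u) :=
  (hu.fderiv_right (m := (⊤ : ℕ∞)) (by simp)).clm_apply contDiff_const

theorem tsupport_partialD_subset (u : Plane → ℝ) (i : Fin 2) :
    tsupport (partialD i u) ⊆ tsupport u := by
  refine (closure_mono ?_).trans (tsupport_fderiv_subset ℝ (f := u))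
  intro x hx hz
  exact hx (by rw [partialD, hz, zero_apply])

theorem partialD_comm {u : Plane → ℝ} (hu : ContDiff ℝ (⊤ : ℕ∞) u) (i j : Fin 2) (x : Plane) :
    partialD j (partialD i u) x = partialD i (partialD j u) x := by
  have hd : DifferentiableAt ℝ (fderiv ℝ u) x :=
    (hu.fderiv_right (m := (⊤ : ℕ∞)) (by simp)).differentiable (by simp) x
  have key : ∀ i j : Fin 2, partialD j (partialD i u) x =
      fderiv ℝ (fderiv ℝ u) x (EuclideanSpace.single j 1) (EuclideanSpace.single i 1) := by
    intro i j
    unfold partialD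
    rw [fderiv_clm_apply hd (differentiableAt_const _)]
    simp
  rw [key, key]
  exact (hu.contDiffAt.isSymmSndFDerivAt (by simpa using WithTop.coe_le_coe.2 (le_top (a := (2 : ℕ∞))))).eq _ _

/-- The partial derivative of a test function, as a test function. -/
def Test.partialD (ψ : Test) (i : Fin 2) : Test where
  toFun := WillmoreGraph.partialD i ψ
  contDiff' := contDiff_partialD ψ.contDiff i
  hasCompactSupport' := ψ.hasCompactSupport.mono' ((subset_tsupport _).trans
    (tsupport_partialD_subset ψ i))
  tsupport_subset' := (tsupport_partialD_subset ψ i).trans ψ.tsupport_subset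

@[simp]
theorem Test.coe_partialD (ψ : Test) (i : Fin 2) :
    (Test.partialD ψ i : Plane → ℝ) = WillmoreGraph.partialD i ψ := rfl

theorem Test.eq_zero_of_notMem (ψ : Test) {x : Plane} (hx : x ∉ interior square) : ψ x = 0 := by
  by_contra h
  exact hx (ψ.tsupport_subset (subset_tsupport _ h))

theorem Test.setIntegral_mul (u : Plane → ℝ) (ψ : Test) :
    ∫ x in interior square, u x * ψ x = ∫ x, u x * ψ x := by
  apply setIntegral_eq_integral_of_forall_compl_eq_zero
  intro x hx
  rw [ψ.eq_zero_of_notMem hx, mul_zero]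

theorem Test.integrable_mul {u : Plane → ℝ} (hu : Continuous u) (ψ : Test) :
    Integrable fun x => u x * ψ x :=
  (hu.mul ψ.continuous).integrable_of_hasCompactSupport ψ.hasCompactSupport.mul_left

theorem isWeakPartial_of_contDiff {u : Plane → ℝ} (hu : ContDiff ℝ (⊤ : ℕ∞) u) (i : Fin 2) :
    IsWeakPartial i u (partialD i u) := by
  intro ψ
  rw [Test.setIntegral_mul, ← Test.coe_partialD, Test.setIntegral_mul]
  exact integral_mul_fderiv_eq_neg_fderiv_mul_of_integrable
    (Test.integrable_mul (contDiff_partialD hu i).continuous ψ)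
    (Test.integrable_mul hu.continuous (ψ.partialD i))
    (Test.integrable_mul hu.continuous ψ)
    (fun x _ => hu.differentiable (by simp) x)
    (fun x _ => ψ.contDiff.differentiable (by simp) x)

theorem integral_partialD_test (ψ : Test) (i : Fin 2) :
    ∫ x in square, partialD i ψ x = 0 := by
  have h := isWeakPartial_of_contDiff (u := fun _ => (1 : ℝ)) contDiff_const i ψ
  have h0 : partialD i (fun _ => (1 : ℝ)) = fun _ => 0 := by
    funext x
    simp [partialD]
  rw [h0, restrict_interior_square] at h
  simpa using h

theorem Test.memLp_top (ψ : Test) : MemLp ψ ∞ (volume.restrict square) :=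
  (ψ.continuous.memLp_top_of_hasCompactSupport ψ.hasCompactSupport volume).restrict _

/-! ### Averages of the Hessian -/

/-- Duality of `L^∞` and `L¹`: no uniform bound on the `g n` is needed, because only one factor of
the product varies. -/
theorem tendsto_integral_mul_of_bounded {h f : Plane → ℝ} {g : ℕ → Plane → ℝ}
    (hh : MemLp h ∞ (volume.restrict square)) (hf : MemLp f ∞ (volume.restrict square))
    (hg : ∀ n, MemLp (g n) ∞ (volume.restrict square))
    (hlim : Tendsto (fun n => eLpNorm (fun x => f x - g n x) 1 (volume.restrict square))
      atTop (𝓝 0)) :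
    Tendsto (fun n => ∫ x in square, h x * g n x) atTop (𝓝 (∫ x in square, h x * f x)) := by
  have hmul : ∀ {a : Plane → ℝ}, MemLp a ∞ (volume.restrict square) →
      Integrable (fun x => h x * a x) (volume.restrict square) := by
    intro a ha
    exact (MemLp.mul (r := ∞) ha hh).integrable le_top
  apply tendsto_integral_of_L1 _ (hmul hf).aestronglyMeasurable (Eventually.of_forall fun n => hmul (hg n))
  have hb : ∀ n, ∫⁻ x in square, ‖h x * g n x - h x * f x‖ₑ ≤
      eLpNorm h ∞ (volume.restrict square) *
        eLpNorm (fun x => f x - g n x) 1 (volume.restrict square) := by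
    intro n
    have hm := eLpNorm_smul_le_eLpNorm_top_mul_eLpNorm 1
      (hf.sub (hg n)).aestronglyMeasurable h (μ := volume.restrict square)
    refine le_trans (le_of_eq ?_) hm
    rw [eLpNorm_one_eq_lintegral_enorm]
    refine lintegral_congr fun x => ?_
    rw [← mul_sub, ← enorm_neg]
    congr 1
    simp only [Pi.smul_apply', Pi.sub_apply, smul_eq_mul]
    ring
  refine tendsto_of_tendsto_of_tendsto_of_le_of_le tendsto_const_nhds ?_ (fun n => zero_le) hb
  have := ENNReal.Tendsto.const_mul hlim (Or.inr hh.eLpNorm_ne_top)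
  simpa using this

theorem integral_hess_eq_zero {φ : Plane → ℝ} {G : Fin 2 → Plane → ℝ} {H : Plane → Mat}
    (h : IsW2InftyZero φ G H) (i j : Fin 2) : ∫ x in square, H x i j = 0 := by
  obtain ⟨h1, ψ, -, -, hH⟩ := h
  have := tendsto_integral_mul_of_bounded (h := fun _ => 1) (memLp_const 1)
    (h1.bounded_hess i j) (fun n => (((ψ n).partialD i).partialD j).memLp_top) (hH i j)
  simp only [one_mul] at this
  refine tendsto_nhds_unique this ?_
  have hz : ∀ n, ∫ x in square, partialD j (partialD i (ψ n)) x = 0 := fun n =>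
    integral_partialD_test ((ψ n).partialD i) j
  simp only [Test.coe_partialD, hz]
  exact tendsto_const_nhds

/-- Symmetry is inherited from the smooth Hessians through their `L¹` limit. -/
theorem hess_symm_ae {φ : Plane → ℝ} {G : Fin 2 → Plane → ℝ} {H : Plane → Mat}
    (h : IsW2InftyZero φ G H) : ∀ᵐ x ∂(volume.restrict square), H x 0 1 = H x 1 0 := by
  obtain ⟨h1, ψ, -, -, hH⟩ := h
  have hm : ∀ i j n, AEStronglyMeasurable
      (fun x => H x i j - partialD j (partialD i (ψ n)) x) (volume.restrict square) := fun i j n =>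
    ((h1.bounded_hess i j).sub (((ψ n).partialD i).partialD j).memLp_top).aestronglyMeasurable
  have hle : ∀ n, eLpNorm (fun x => H x 0 1 - H x 1 0) 1 (volume.restrict square) ≤
      eLpNorm (fun x => H x 0 1 - partialD 1 (partialD 0 (ψ n)) x) 1 (volume.restrict square) +
      eLpNorm (fun x => H x 1 0 - partialD 0 (partialD 1 (ψ n)) x) 1 (volume.restrict square) := by
    intro n
    refine le_trans (le_of_eq ?_) (eLpNorm_sub_le (hm 0 1 n) (hm 1 0 n) le_rfl)
    congr 1
    funext x
    simp only [Pi.sub_apply]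
    rw [partialD_comm (ψ n).contDiff 0 1]
    ring
  have hlim := (hH 0 1).add (hH 1 0)
  rw [add_zero] at hlim
  have hz := le_antisymm (ge_of_tendsto' hlim hle) zero_le
  rw [eLpNorm_eq_zero_iff (f := fun x => H x 0 1 - H x 1 0) ((h1.bounded_hess 0 1).sub (h1.bounded_hess 1 0)).aestronglyMeasurable
    one_ne_zero] at hz
  filter_upwards [hz] with x hx
  exact sub_eq_zero.1 hx

/-- Only one factor of each product is approximated. With `ψ` a test function, `∫ H₀₀ ∂₁∂₁ψ` and `∫
H₀₁ ∂₀∂₁ψ` both equal `-∫ G₀ ∂₀∂₁∂₁ψ`; in the limit `∫ H₀₀ H₁₁ = ∫ H₀₁ H₁₀`. -/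
theorem integral_det_hess_eq_zero {φ : Plane → ℝ} {G : Fin 2 → Plane → ℝ} {H : Plane → Mat}
    (h : IsW2InftyZero φ G H) : ∫ x in square, (H x).det = 0 := by
  have h' := h
  obtain ⟨h1, ψ, -, -, hH⟩ := h'
  have hlim : ∀ i j k l, Tendsto (fun n => ∫ x in square,
      H x i j * partialD l (partialD k (ψ n)) x) atTop (𝓝 (∫ x in square, H x i j * H x k l)) :=
    fun i j k l => tendsto_integral_mul_of_bounded (h1.bounded_hess i j)
      (h1.bounded_hess k l) (fun n => (((ψ n).partialD k).partialD l).memLp_top) (hH k l)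
  have hparts : ∀ n, ∫ x in square, H x 0 0 * partialD 1 (partialD 1 (ψ n)) x =
      ∫ x in square, H x 0 1 * partialD 0 (partialD 1 (ψ n)) x := by
    intro n
    have e1 := h1.hess 0 0 (((ψ n).partialD 1).partialD 1)
    have e2 := h1.hess 0 1 (((ψ n).partialD 1).partialD 0)
    simp only [Test.coe_partialD, restrict_interior_square] at e1 e2
    have e3 : partialD 0 (partialD 1 (partialD 1 (ψ n))) =
        partialD 1 (partialD 0 (partialD 1 (ψ n))) :=
      funext fun x => partialD_comm (contDiff_partialD (ψ n).contDiff 1) 1 0 x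
    rw [e3] at e1
    linarith
  have heq := tendsto_nhds_unique ((hlim 0 0 1 1).congr hparts) (hlim 0 1 1 0)
  have hint : ∀ i j k l, Integrable (fun x => H x i j * H x k l) (volume.restrict square) :=
    fun i j k l => (MemLp.mul (r := ∞) (h1.bounded_hess k l) (h1.bounded_hess i j)).integrable le_top
  simp only [Matrix.det_fin_two]
  rw [integral_sub (hint 0 0 1 1) (hint 0 1 1 0), heq, sub_self]

/-- Test functions belong to `W^{2,∞}_0`. -/
theorem Test.isW2InftyZero (ψ : Test) :
    IsW2InftyZero ψ (fun i => WillmoreGraph.partialD i ψ)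
      (fun x => Matrix.of fun i j => WillmoreGraph.partialD j (WillmoreGraph.partialD i ψ) x) := by
  refine ⟨⟨ψ.memLp_top, fun i => (ψ.partialD i).memLp_top,
    fun i j => ((ψ.partialD i).partialD j).memLp_top,
    isWeakPartial_of_contDiff ψ.contDiff, fun i j =>
      isWeakPartial_of_contDiff (contDiff_partialD ψ.contDiff i) j⟩, fun _ => ψ, ?_, ?_, ?_⟩
  · simp
  · simp
  · simp

/-! ### A quadratic minorant of the integrand -/

/-- The sum of an affine function and a multiple of the determinant which touches `F_λ` from
below. -/
def minorant (lam m σ τ : ℝ) (X : Mat) : ℝ :=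
  2 * m * (σ * X 0 0 + τ * X 1 1) - m ^ 2 + lam - 2 * (σ * τ) * X.det

theorem frobSq_eq (X : Mat) : frobSq X = X 0 0 ^ 2 + X 0 1 ^ 2 + (X 1 0 ^ 2 + X 1 1 ^ 2) := by
  simp [frobSq, Fin.sum_univ_two]

theorem frobSq_eq_zero_iff {X : Mat} : frobSq X = 0 ↔ X = 0 := by
  constructor
  · intro h
    rw [frobSq_eq] at h
    ext i j
    fin_cases i <;> fin_cases j <;> simp only [Matrix.zero_apply] <;>
      refine pow_eq_zero_iff two_ne_zero |>.1 ?_ <;> dsimp <;>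
      nlinarith [sq_nonneg (X 0 0), sq_nonneg (X 0 1), sq_nonneg (X 1 0), sq_nonneg (X 1 1)]
  · rintro rfl
    simp [frobSq]

theorem minorant_le_bigF {lam m σ τ : ℝ} (hm : √lam ≤ m) (hσ : σ ^ 2 = 1)
    (hτ : τ ^ 2 = 1) {X : Mat} (hX : X 0 1 = X 1 0) : minorant lam m σ τ X ≤ bigF lam X := by
  unfold bigF
  split_ifs with h
  · rw [h]
    have := (Real.sqrt_le_left ((Real.sqrt_nonneg lam).trans hm)).1 hm
    simp [minorant]
    linarith
  · rw [frobSq_eq, minorant, Matrix.det_fin_two, hX]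
    have h1 : 0 ≤ (σ * X 0 0 + τ * X 1 1 - m) ^ 2 := sq_nonneg _
    have h2 : σ * τ ≤ 1 := by nlinarith [sq_nonneg (σ - τ)]
    have h3 : 0 ≤ (1 - σ * τ) * X 1 0 ^ 2 := mul_nonneg (by linarith) (sq_nonneg _)
    have e1 : σ ^ 2 * X 0 0 ^ 2 = X 0 0 ^ 2 := by rw [hσ, one_mul]
    have e2 : τ ^ 2 * X 1 1 ^ 2 = X 1 1 ^ 2 := by rw [hτ, one_mul]
    nlinarith

/-- Without off-diagonal entries the gap is the single square `(σ x + τ y - m)²`. -/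
theorem bigF_diagonal_eq_minorant {lam m σ τ x y : ℝ} (hσ : σ ^ 2 = 1) (hτ : τ ^ 2 = 1)
    (hne : x ≠ 0 ∨ y ≠ 0) (hxy : σ * x + τ * y = m) :
    bigF lam (Matrix.diagonal ![x, y]) = minorant lam m σ τ (Matrix.diagonal ![x, y]) := by
  have hX : (Matrix.diagonal ![x, y] : Mat) ≠ 0 := by
    intro h
    have h0 := congrFun (congrFun h 0) 0
    have h1 := congrFun (congrFun h 1) 1
    simp at h0 h1
    tauto
  rw [bigF, if_neg hX, frobSq_eq, minorant, Matrix.det_fin_two]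
  simp
  rw [← hxy]
  linear_combination (-x ^ 2) * hσ - y ^ 2 * hτ

/-- The gap at zero is `m² - λ`, so the zero matrix is an admissible phase when `m = √λ`. -/
theorem bigF_zero_eq_minorant {lam σ τ : ℝ} (hlam : 0 ≤ lam) :
    bigF lam 0 = minorant lam √lam σ τ 0 := by
  simp [bigF, minorant, Real.sq_sqrt hlam]

theorem continuous_minorant (lam m σ τ : ℝ) : Continuous (minorant lam m σ τ) := by
  unfold minorant
  fun_prop

theorem continuous_frobSq : Continuous frobSq := by
  unfold frobSq
  fun_prop

theorem bigF_le {lam : ℝ} (hlam : 0 ≤ lam) (X : Mat) : bigF lam X ≤ frobSq X + lam := by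
  unfold bigF
  split_ifs with h
  · rw [frobSq_eq_zero_iff.2 h, zero_add]
    exact hlam
  · exact le_rfl

theorem bigF_nonneg {lam : ℝ} (hlam : 0 ≤ lam) (X : Mat) : 0 ≤ bigF lam X := by
  unfold bigF
  split_ifs with h
  · exact le_rfl
  · rw [frobSq_eq]
    positivity

/-! ### Integrals of the transformed integrand -/

theorem congr_apply (N X : Mat) (i j : Fin 2) : (N * X * N.transpose) i j =
    N i 0 * N j 0 * X 0 0 + N i 0 * N j 1 * X 0 1 + (N i 1 * N j 0 * X 1 0 +
      N i 1 * N j 1 * X 1 1) := by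
  simp [Matrix.mul_apply, Fin.sum_univ_two]
  ring

theorem congr_symm {N X : Mat} (hX : X 0 1 = X 1 0) :
    (N * X * N.transpose) 0 1 = (N * X * N.transpose) 1 0 := by
  rw [congr_apply, congr_apply, hX]
  ring

theorem memLp_congr_entry {ξ N : Mat} {H : Plane → Mat}
    (hH : ∀ i j, MemLp (fun x => H x i j) ∞ (volume.restrict square)) (i j : Fin 2) :
    MemLp (fun x => (N * (ξ + H x) * N.transpose) i j) ∞ (volume.restrict square) := by
  simp only [congr_apply, Matrix.add_apply]
  have h : ∀ (c : ℝ) k l, MemLp (fun x => c * (ξ k l + H x k l)) ∞ (volume.restrict square) :=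
    fun c k l => ((memLp_const (ξ k l)).add (hH k l)).const_mul c
  exact ((h _ 0 0).add (h _ 0 1)).add ((h _ 1 0).add (h _ 1 1))

theorem integrable_bigF {lam : ℝ} (hlam : 0 ≤ lam) {ξ N : Mat} {H : Plane → Mat}
    (hH : ∀ i j, MemLp (fun x => H x i j) ∞ (volume.restrict square)) :
    Integrable (fun x => bigF lam (N * (ξ + H x) * N.transpose)) (volume.restrict square) := by
  have hsq : ∀ i j, MemLp (fun x => (N * (ξ + H x) * N.transpose) i j ^ 2) ∞
      (volume.restrict square) := by
    intro i j
    simp only [pow_two]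
    exact MemLp.mul (r := ∞) (memLp_congr_entry hH i j) (memLp_congr_entry hH i j)
  have hfrob : MemLp (fun x => frobSq (N * (ξ + H x) * N.transpose)) ∞
      (volume.restrict square) := by
    simp only [frobSq_eq]
    exact ((hsq 0 0).add (hsq 0 1)).add ((hsq 1 0).add (hsq 1 1))
  -- `F_λ` jumps at zero, but it is a Borel function of the squared norm.
  have hk : Measurable fun y : ℝ => if y = 0 then 0 else y + lam :=
    Measurable.ite (measurableSet_singleton 0) measurable_const (measurable_id.add_const lam)
  have heq : (fun x => bigF lam (N * (ξ + H x) * N.transpose)) =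
      fun x => (fun y : ℝ => if y = 0 then 0 else y + lam)
        (frobSq (N * (ξ + H x) * N.transpose)) := by
    funext x
    simp only [bigF, frobSq_eq_zero_iff]
  refine ((hfrob.add (memLp_const lam)).integrable le_top).mono' ?_ ?_
  · rw [heq]
    exact (hk.comp_aemeasurable hfrob.aestronglyMeasurable.aemeasurable).aestronglyMeasurable
  · refine Eventually.of_forall fun x => ?_
    rw [Real.norm_of_nonneg (bigF_nonneg hlam _)]
    exact bigF_le hlam _

/-- Affine functions plus multiples of the determinant are stable under translation and congruence:
the congruence scales the determinant by `N.det ^ 2`, the translation adds linear terms. -/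
theorem minorant_congr_add (lam m σ τ : ℝ) (N ξ : Mat) : ∃ c₀ c₁ c₂ c₃ d : ℝ, ∀ X : Mat,
    minorant lam m σ τ (N * (ξ + X) * N.transpose) =
      minorant lam m σ τ (N * ξ * N.transpose) + (c₀ * X 0 0 + c₁ * X 0 1 + c₂ * X 1 0 +
        c₃ * X 1 1 + d * X.det) := by
  refine ⟨2 * m * (σ * N 0 0 ^ 2 + τ * N 1 0 ^ 2) - 2 * (σ * τ) * N.det ^ 2 * ξ 1 1,
    2 * m * (σ * (N 0 0 * N 0 1) + τ * (N 1 0 * N 1 1)) + 2 * (σ * τ) * N.det ^ 2 * ξ 1 0,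
    2 * m * (σ * (N 0 0 * N 0 1) + τ * (N 1 0 * N 1 1)) + 2 * (σ * τ) * N.det ^ 2 * ξ 0 1,
    2 * m * (σ * N 0 1 ^ 2 + τ * N 1 1 ^ 2) - 2 * (σ * τ) * N.det ^ 2 * ξ 0 0,
    - 2 * (σ * τ) * N.det ^ 2, fun X => ?_⟩
  simp only [minorant, Matrix.det_mul, Matrix.det_transpose, congr_apply, Matrix.add_apply]
  simp only [Matrix.det_fin_two, Matrix.add_apply]
  ring

/-- The integral of the minorant depends only on the mean of the Hessian. -/
theorem integral_minorant (lam m σ τ : ℝ) (N ξ : Mat) {φ : Plane → ℝ} {G : Fin 2 → Plane → ℝ}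
    {H : Plane → Mat} (h : IsW2InftyZero φ G H) :
    Integrable (fun x => minorant lam m σ τ (N * (ξ + H x) * N.transpose))
      (volume.restrict square) ∧
    ∫ x in square, minorant lam m σ τ (N * (ξ + H x) * N.transpose) =
      minorant lam m σ τ (N * ξ * N.transpose) := by
  obtain ⟨c₀, c₁, c₂, c₃, d, hc⟩ := minorant_congr_add lam m σ τ N ξ
  have hH := h.1.bounded_hess
  have hi : ∀ (c : ℝ) i j, Integrable (fun x => c * H x i j) (volume.restrict square) :=
    fun c i j => ((hH i j).const_mul c).integrable le_top
  have hd : Integrable (fun x => d * (H x).det) (volume.restrict square) := by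
    simp only [Matrix.det_fin_two]
    exact (((MemLp.mul (r := ∞) (hH 1 1) (hH 0 0)).sub
      (MemLp.mul (r := ∞) (hH 1 0) (hH 0 1))).const_mul d).integrable le_top
  have i1 := (hi c₀ 0 0).fun_add (hi c₁ 0 1)
  have i2 := i1.fun_add (hi c₂ 1 0)
  have i3 := i2.fun_add (hi c₃ 1 1)
  have i4 := i3.fun_add hd
  have i0 : Integrable (fun _ : Plane => minorant lam m σ τ (N * ξ * N.transpose))
    (volume.restrict square) := integrable_const _
  simp only [hc]
  refine ⟨i0.add i4, ?_⟩
  rw [integral_add i0 i4, integral_add i3 hd, integral_add i2 (hi c₃ 1 1),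
    integral_add i1 (hi c₂ 1 0), integral_add (hi c₀ 0 0) (hi c₁ 0 1)]
  simp only [integral_const_mul, integral_hess_eq_zero h, integral_det_hess_eq_zero h]
  simp

theorem minorant_le_integral {lam m σ τ : ℝ} (hlam : 0 ≤ lam) (hm : √lam ≤ m) (hσ : σ ^ 2 = 1)
    (hτ : τ ^ 2 = 1) (N : Mat) {ξ : Mat} (hξ : ξ 0 1 = ξ 1 0) {φ : Plane → ℝ}
    {G : Fin 2 → Plane → ℝ} {H : Plane → Mat} (h : IsW2InftyZero φ G H) :
    minorant lam m σ τ (N * ξ * N.transpose) ≤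
      ∫ x in square, bigF lam (N * (ξ + H x) * N.transpose) := by
  obtain ⟨hi, he⟩ := integral_minorant lam m σ τ N ξ h
  rw [← he]
  refine integral_mono_ae hi (integrable_bigF hlam h.1.bounded_hess) ?_
  filter_upwards [hess_symm_ae h] with x hx
  refine minorant_le_bigF hm hσ hτ (congr_symm ?_)
  rw [Matrix.add_apply, Matrix.add_apply, hξ, hx]

/-! ### Laminates with compact support -/

/-- The product of a test function with a smooth function. -/
def Test.mulSmooth (η : Test) (u : Plane → ℝ) (hu : ContDiff ℝ (⊤ : ℕ∞) u) : Test where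
  toFun x := η x * u x
  contDiff' := η.contDiff.mul hu
  hasCompactSupport' := η.hasCompactSupport.mul_right
  tsupport_subset' := (tsupport_mul_subset_left (f := η) (g := u)).trans η.tsupport_subset

@[simp]
theorem Test.mulSmooth_apply (η : Test) (u : Plane → ℝ) (hu : ContDiff ℝ (⊤ : ℕ∞) u) (x : Plane) :
    η.mulSmooth u hu x = η x * u x := rfl

/-- A cut-off function which equals one off a set of small measure. -/
theorem exists_cutoff {κ : ℝ} (hκ : 0 < κ) : ∃ (η : Test) (B : Set Plane),
    (∀ x, η x ∈ Set.Icc (0 : ℝ) 1) ∧ MeasurableSet B ∧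
    volume.restrict square B ≤ ENNReal.ofReal κ ∧ ∀ x ∉ B, ∀ᶠ y in 𝓝 x, η y = 1 := by
  obtain ⟨K, hKQ, hK, hKκ⟩ := (isOpen_interior (s := square)).measurableSet.exists_isCompact_sdiff_lt
    (μ := volume.restrict square) (measure_ne_top _ _) (ENNReal.ofReal_pos.2 hκ).ne'
  obtain ⟨T, hT, hKT, hTQ⟩ := exists_compact_between hK isOpen_interior hKQ
  obtain ⟨η, hη1, hη0, hη⟩ := exists_contMDiffMap_one_nhds_of_subset_interior (n := (⊤ : ℕ∞))
    𝓘(ℝ, Plane) hK.isClosed hKT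
  have hts : tsupport η ⊆ T := by
    refine closure_minimal (fun x hx => ?_) hT.isClosed
    by_contra h
    exact hx (hη0 x h)
  refine ⟨⟨η, η.contMDiff.contDiff, HasCompactSupport.of_support_subset_isCompact hT
    ((subset_tsupport _).trans hts), hts.trans hTQ⟩, Kᶜ, hη, hK.measurableSet.compl, ?_, ?_⟩
  · refine le_trans ?_ hKκ.le
    have hnull : volume.restrict square (interior square)ᶜ = 0 := by
      rw [← restrict_interior_square, Measure.restrict_apply isOpen_interior.measurableSet.compl,
        Set.compl_inter_self, measure_empty]
    calc volume.restrict square Kᶜ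
        ≤ volume.restrict square (interior square \ K ∪ (interior square)ᶜ) := by
          refine measure_mono fun x hx => ?_
          by_cases h : x ∈ interior square
          · exact Or.inl ⟨h, hx⟩
          · exact Or.inr h
      _ ≤ _ := (measure_union_le _ _).trans (by rw [hnull, add_zero])
  · intro x hx
    exact hη1.filter_mono (nhds_le_nhdsSet (not_not.1 hx))

/-- The Hessian of `η(x) w(ℓ x)`. -/
theorem partialD_partialD_mul_comp {η : Plane → ℝ} (hη : ContDiff ℝ (⊤ : ℕ∞) η)
    (ℓ : Plane →L[ℝ] ℝ) {w w' w'' : ℝ → ℝ} (hw : ∀ x, HasDerivAt w (w' x) x)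
    (hw' : ∀ x, HasDerivAt w' (w'' x) x) (i j : Fin 2) (x : Plane) :
    partialD j (partialD i fun x => η x * w (ℓ x)) x =
      η x * w'' (ℓ x) * (ℓ (EuclideanSpace.single i 1) * ℓ (EuclideanSpace.single j 1)) +
      (partialD j (partialD i η) x * w (ℓ x) +
      partialD i η x * w' (ℓ x) * ℓ (EuclideanSpace.single j 1) +
      partialD j η x * w' (ℓ x) * ℓ (EuclideanSpace.single i 1)) := by
  have key : ∀ (a : Plane → ℝ) (b b' : ℝ → ℝ) (y : Plane),
      ContDiff ℝ (⊤ : ℕ∞) a → (∀ x, HasDerivAt b (b' x) x) →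
      HasFDerivAt (fun x => a x * b (ℓ x)) (a y • (b' (ℓ y) • ℓ) + b (ℓ y) • fderiv ℝ a y) y := by
    intro a b b' y ha hb
    exact (ha.differentiable (by simp) y).hasFDerivAt.mul
      ((hb (ℓ y)).comp_hasFDerivAt y ℓ.hasFDerivAt)
  have h1 : partialD i (fun x => η x * w (ℓ x)) = fun x =>
      partialD i η x * w (ℓ x) + ℓ (EuclideanSpace.single i 1) * (η x * w' (ℓ x)) := by
    funext y
    rw [partialD, (key η w w' y hη hw).fderiv]
    simp only [add_apply, smul_apply, smul_eq_mul, partialD]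
    ring
  rw [h1, partialD, ((key _ w w' x (contDiff_partialD hη i) hw).fun_add
    ((key η w' w'' x hη hw').const_mul _)).fderiv]
  simp only [add_apply, smul_apply, smul_eq_mul, partialD]
  ring

theorem partialD_eq_zero_of_eventually_const {u : Plane → ℝ} {c : ℝ} {x : Plane}
    (h : ∀ᶠ y in 𝓝 x, u y = c) (i : Fin 2) : ∀ᶠ y in 𝓝 x, partialD i u y = 0 := by
  filter_upwards [h.eventually_nhds] with y hy
  rw [partialD, (show u =ᶠ[𝓝 y] fun _ => c from hy).fderiv_eq]
  simp

/-- Level lines of a nonzero linear form are Lebesgue null. Using this push-forward in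
`exists_profile` measures the bad set directly in the square. -/
theorem nullSingletonClass_map (ℓ : Plane →L[ℝ] ℝ) (hℓ : ℓ ≠ 0) :
    NullSingletonClass ((volume.restrict square).map ℓ) := by
  refine ⟨fun r => ?_⟩
  rw [Measure.map_apply ℓ.continuous.measurable (measurableSet_singleton r)]
  refine le_antisymm ((Measure.restrict_apply_le _ _).trans ?_) zero_le
  have hsurj : Function.Surjective (ℓ : Plane →ₗ[ℝ] ℝ) := by
    apply LinearMap.surjective
    intro h
    exact hℓ (ContinuousLinearMap.coe_injective h)
  obtain ⟨c, -, hc⟩ := LinearMap.exists_map_addHaar_eq_smul_addHaar (ℓ : Plane →ₗ[ℝ] ℝ)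
    volume volume hsurj
  have h2 := congrArg (fun m : Measure ℝ => m {r}) hc
  simp only [Measure.smul_apply, Real.volume_singleton, smul_zero] at h2
  rw [Measure.map_apply (by exact ℓ.continuous.measurable) (measurableSet_singleton r)] at h2
  exact h2.le

theorem exists_bound_derivatives (η : Test) : ∃ C : ℝ, 1 ≤ C ∧ ∀ x i j,
    |partialD i η x| ≤ C ∧ |partialD j (partialD i η) x| ≤ C := by
  have h : ∀ ψ : Test, ∃ C : ℝ, ∀ x, |ψ x| ≤ C := fun ψ =>
    ψ.hasCompactSupport.exists_bound_of_continuous ψ.continuous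
  choose C hC using h
  refine ⟨1 + ∑ i, |C (η.partialD i)| + ∑ i, ∑ j, |C ((η.partialD i).partialD j)|, ?_, ?_⟩
  · have : 0 ≤ ∑ i, |C (η.partialD i)| := Finset.sum_nonneg fun _ _ => abs_nonneg _
    have : 0 ≤ ∑ i, ∑ j, |C ((η.partialD i).partialD j)| :=
      Finset.sum_nonneg fun _ _ => Finset.sum_nonneg fun _ _ => abs_nonneg _
    linarith
  · intro x i j
    have h0 : 0 ≤ ∑ i, |C (η.partialD i)| := Finset.sum_nonneg fun _ _ => abs_nonneg _
    have h0' : 0 ≤ ∑ i, ∑ j, |C ((η.partialD i).partialD j)| :=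
      Finset.sum_nonneg fun _ _ => Finset.sum_nonneg fun _ _ => abs_nonneg _
    have h1 : |C (η.partialD i)| ≤ ∑ i, |C (η.partialD i)| :=
      Finset.single_le_sum (f := fun i => |C (η.partialD i)|) (fun _ _ => abs_nonneg _)
        (Finset.mem_univ i)
    have h2 : |C ((η.partialD i).partialD j)| ≤ ∑ i, ∑ j, |C ((η.partialD i).partialD j)| :=
      (Finset.single_le_sum (f := fun j => |C ((η.partialD i).partialD j)|)
        (fun _ _ => abs_nonneg _) (Finset.mem_univ j)).trans
      (Finset.single_le_sum (f := fun i => ∑ j, |C ((η.partialD i).partialD j)|)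
        (fun _ _ => Finset.sum_nonneg fun _ _ => abs_nonneg _) (Finset.mem_univ i))
    have h3 := (hC (η.partialD i) x).trans (le_abs_self _)
    have h4 := (hC ((η.partialD i).partialD j) x).trans (le_abs_self _)
    simp only [Test.coe_partialD] at h3 h4
    constructor <;> linarith

/-- A laminate `η(x) w(ℓ x)`: its Hessian is close to `η w''(ℓ x) ℓ ⊗ ℓ`, with equality where `η` is
locally constant, and `w''` takes the values `s` and `t` off a set of small measure. -/
theorem exists_laminate (η : Test) (ℓ : Plane →L[ℝ] ℝ) (hℓ : ℓ ≠ 0) {s t : ℝ} (hst : s * t ≤ 0)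
    {κ : ℝ} (hκ : 0 < κ) : ∃ (w w'' χ : ℝ → ℝ) (B : Set Plane), ContDiff ℝ (⊤ : ℕ∞) w ∧
      ContDiff ℝ (⊤ : ℕ∞) χ ∧ (∀ x, χ x ∈ Set.Icc (0 : ℝ) 1) ∧ (∀ x, |w'' x| ≤ |s| + |t|) ∧
      MeasurableSet B ∧ volume.restrict square B ≤ ENNReal.ofReal κ ∧
      (∀ x i j, |partialD j (partialD i fun x => η x * w (ℓ x)) x - η x * w'' (ℓ x) *
        (ℓ (EuclideanSpace.single i 1) * ℓ (EuclideanSpace.single j 1))| ≤ κ) ∧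
      (∀ x i j c, (∀ᶠ y in 𝓝 x, η y = c) →
        partialD j (partialD i fun x => η x * w (ℓ x)) x = c * w'' (ℓ x) *
          (ℓ (EuclideanSpace.single i 1) * ℓ (EuclideanSpace.single j 1))) ∧
      ∀ x ∉ B, (w'' (ℓ x) = s ∧ ∀ᶠ y in 𝓝 x, χ (ℓ y) = 0) ∨
        (w'' (ℓ x) = t ∧ ∀ᶠ y in 𝓝 x, χ (ℓ y) = 1) := by
  -- The error consists of one term in `w`, needed small only on the support of `η`, where `|ℓ| ≤
  -- R`, and two terms in `w'` carrying a factor `‖ℓ‖`; hence `1 + 2 * ‖ℓ‖` below.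
  obtain ⟨C, hC1, hC⟩ := exists_bound_derivatives η
  obtain ⟨R, hR⟩ := η.hasCompactSupport.exists_bound_of_continuousOn
    (f := ℓ) ℓ.continuous.continuousOn
  set κ' := κ / (C * (1 + 2 * ‖ℓ‖)) with hκ'
  have hD : 1 ≤ C * (1 + 2 * ‖ℓ‖) := by nlinarith [norm_nonneg ℓ]
  have hκ'0 : 0 < κ' := by positivity
  have hκ'κ : κ' ≤ κ := div_le_self hκ.le hD
  have := nullSingletonClass_map ℓ hℓ
  obtain ⟨w, w', w'', χ, B, hw, hχ, hwd, hwd', hχ01, hw'', hw'b, hwb, hB, hνB, hval⟩ :=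
    exists_profile ((volume.restrict square).map ℓ) hst R hκ'0
  refine ⟨w, w'', χ, ℓ ⁻¹' B, hw, hχ, hχ01, hw'', hB.preimage ℓ.continuous.measurable, ?_, ?_, ?_,
    ?_⟩
  · rw [← Measure.map_apply ℓ.continuous.measurable hB]
    exact hνB.trans (ENNReal.ofReal_le_ofReal hκ'κ)
  · intro x i j
    rw [partialD_partialD_mul_comp η.contDiff ℓ hwd hwd', add_sub_cancel_left]
    have he : ∀ k : Fin 2, |ℓ (EuclideanSpace.single k 1)| ≤ ‖ℓ‖ := fun k => by
      have := ℓ.le_opNorm (EuclideanSpace.single k 1)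
      simpa using this
    have t1 : |partialD j (partialD i η) x * w (ℓ x)| ≤ C * κ' := by
      by_cases hx : x ∈ tsupport η
      · rw [abs_mul]
        exact mul_le_mul (hC x i j).2 (hwb _ (hR x hx)) (abs_nonneg _) (by linarith)
      · have : partialD j (partialD i η) x = 0 := by
          by_contra h
          exact hx (tsupport_partialD_subset _ i (tsupport_partialD_subset _ j
            (subset_tsupport _ h)))
        rw [this, zero_mul, abs_zero]
        positivity
    have t2 : ∀ i j, |partialD i η x * w' (ℓ x) * ℓ (EuclideanSpace.single j 1)| ≤
        C * κ' * ‖ℓ‖ := by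
      intro i j
      rw [abs_mul, abs_mul]
      exact mul_le_mul (mul_le_mul (hC x i j).1 (hw'b _) (abs_nonneg _) (by linarith)) (he j)
        (abs_nonneg _) (by positivity)
    have hsum : C * κ' + C * κ' * ‖ℓ‖ + C * κ' * ‖ℓ‖ = κ := by
      rw [hκ']
      field_simp
      ring
    rw [← hsum]
    exact (abs_add_le _ _).trans (add_le_add ((abs_add_le _ _).trans (add_le_add t1 (t2 i j)))
      (t2 j i))
  · intro x i j c hc
    have h1 := fun k => partialD_eq_zero_of_eventually_const hc k
    have h2 := partialD_eq_zero_of_eventually_const (h1 i) j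
    rw [partialD_partialD_mul_comp η.contDiff ℓ hwd hwd', h2.self_of_nhds, (h1 i).self_of_nhds,
      (h1 j).self_of_nhds, hc.self_of_nhds]
    ring
  · intro x hx
    rcases hval (ℓ x) hx with ⟨h1, h2⟩ | ⟨h1, h2⟩
    · exact Or.inl ⟨h1, ℓ.continuous.continuousAt.eventually h2⟩
    · exact Or.inr ⟨h1, ℓ.continuous.continuousAt.eventually h2⟩

/-- The linear form `x ↦ p · x`. -/
def linForm (p : Fin 2 → ℝ) : Plane →L[ℝ] ℝ :=
  p 0 • EuclideanSpace.proj 0 + p 1 • EuclideanSpace.proj 1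

theorem linForm_single (p : Fin 2 → ℝ) (i : Fin 2) : linForm p (EuclideanSpace.single i 1) = p i := by
  fin_cases i <;> simp [linForm]

theorem linForm_ne_zero {p : Fin 2 → ℝ} (hp : p ≠ 0) : linForm p ≠ 0 := by
  intro h
  apply hp
  funext i
  rw [← linForm_single p i, h]
  simp

/-- A second order laminate: the Hessian takes, off a set of small measure, one of the values
`s₁ p ⊗ p`, `t₁ p ⊗ p + s₂ q ⊗ q`, `t₁ p ⊗ p + t₂ q ⊗ q`, and is bounded uniformly in `κ`. -/
theorem exists_second_order_laminate {p q : Fin 2 → ℝ} (hp : p ≠ 0) (hq : q ≠ 0) {s₁ t₁ s₂ t₂ : ℝ}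
    (h₁ : s₁ * t₁ ≤ 0) (h₂ : s₂ * t₂ ≤ 0) {κ : ℝ} (hκ : 0 < κ) :
    ∃ (φ : Test) (B : Set Plane), MeasurableSet B ∧
      volume.restrict square B ≤ ENNReal.ofReal (3 * κ) ∧
      (∀ x i j, |partialD j (partialD i φ) x| ≤
        (|s₁| + |t₁|) * |p i * p j| + (|s₂| + |t₂|) * |q i * q j| + 2 * κ) ∧
      ∀ x ∉ B, ∃ α β : ℝ, (∀ i j, partialD j (partialD i φ) x = α * (p i * p j) + β * (q i * q j)) ∧
        ((α = s₁ ∧ β = 0) ∨ (α = t₁ ∧ β = s₂) ∨ (α = t₁ ∧ β = t₂)) := by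
  obtain ⟨η, B₀, hη, hB₀, hB₀κ, hη1⟩ := exists_cutoff hκ
  obtain ⟨w₁, w₁'', χ, B₁, hw₁, hχ, hχ01, hw₁b, hB₁, hB₁κ, herr₁, hloc₁, hval₁⟩ :=
    exists_laminate η (linForm p) (linForm_ne_zero hp) h₁ hκ
  have hχp : ContDiff ℝ (⊤ : ℕ∞) fun x => χ (linForm p x) := hχ.comp (linForm p).contDiff
  have hw₁p : ContDiff ℝ (⊤ : ℕ∞) fun x => w₁ (linForm p x) := hw₁.comp (linForm p).contDiff
  -- The second oscillation is confined to the phase `t₁` by the cut-off `η χ(p·x)`. Its derivatives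
  -- may be huge, but `w₂` is chosen afterwards, and off the bad sets the cut-off is locally
  -- constant, so the Hessian there is exact.
  obtain ⟨w₂, w₂'', χ₂, B₂, hw₂, -, -, hw₂b, hB₂, hB₂κ, herr₂, hloc₂, hval₂⟩ :=
    exists_laminate (η.mulSmooth _ hχp) (linForm q) (linForm_ne_zero hq) h₂ hκ
  have hw₂q : ContDiff ℝ (⊤ : ℕ∞) fun x => w₂ (linForm q x) := hw₂.comp (linForm q).contDiff
  simp only [linForm_single] at herr₁ hloc₁ herr₂ hloc₂
  let φ₁ : Test := η.mulSmooth _ hw₁p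
  let φ₂ : Test := (η.mulSmooth _ hχp).mulSmooth _ hw₂q
  have hadd : ∀ x i j, partialD j (partialD i (φ₁ + φ₂ : Test)) x =
      partialD j (partialD i φ₁) x + partialD j (partialD i φ₂) x := by
    have h : ∀ (a b : Plane → ℝ), ContDiff ℝ (⊤ : ℕ∞) a → ContDiff ℝ (⊤ : ℕ∞) b → ∀ i,
        partialD i (fun x => a x + b x) = fun x => partialD i a x + partialD i b x := by
      intro a b ha hb i
      funext x
      rw [partialD, fderiv_fun_add (ha.differentiable (by simp) x) (hb.differentiable (by simp) x)]
      rfl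
    intro x i j
    rw [show ((φ₁ + φ₂ : Test) : Plane → ℝ) = fun x => φ₁ x + φ₂ x from rfl,
      h _ _ φ₁.contDiff φ₂.contDiff, h _ _ (contDiff_partialD φ₁.contDiff i)
      (contDiff_partialD φ₂.contDiff i)]
  refine ⟨φ₁ + φ₂, B₀ ∪ (B₁ ∪ B₂), hB₀.union (hB₁.union hB₂), ?_, ?_, ?_⟩
  · refine (measure_union_le _ _).trans ((add_le_add hB₀κ ((measure_union_le _ _).trans
      (add_le_add hB₁κ hB₂κ))).trans (le_of_eq ?_))
    rw [← ENNReal.ofReal_add hκ.le hκ.le, ← ENNReal.ofReal_add hκ.le (by positivity)]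
    congr 1
    ring
  · intro x i j
    rw [hadd]
    have bound : ∀ {e y z M r : ℝ}, |e - y * z * r| ≤ κ → y ∈ Set.Icc (0 : ℝ) 1 → |z| ≤ M →
        |e| ≤ M * |r| + κ := by
      intro e y z M r he hy hz
      have h1 : |y * z * r| ≤ M * |r| := by
        rw [abs_mul, abs_mul, abs_of_nonneg hy.1]
        refine mul_le_mul_of_nonneg_right ?_ (abs_nonneg r)
        nlinarith [abs_nonneg z, hy.2]
      have h2 : |e| ≤ |e - y * z * r| + |y * z * r| := by
        simpa using abs_add_le (e - y * z * r) (y * z * r)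
      linarith
    have b1 := bound (herr₁ x i j) (hη x) (hw₁b _)
    have b2 := bound (herr₂ x i j) ⟨mul_nonneg (hη x).1 (hχ01 _).1,
      mul_le_one₀ (hη x).2 (hχ01 _).1 (hχ01 _).2⟩ (hw₂b _)
    refine (abs_add_le _ _).trans ((add_le_add b1 b2).trans (le_of_eq ?_))
    ring
  · intro x hx
    simp only [Set.mem_union, not_or] at hx
    have hη1x := hη1 x hx.1
    rcases hval₁ x hx.2.1 with ⟨hv, hχx⟩ | ⟨hv, hχx⟩
    · have hz : ∀ᶠ y in 𝓝 x, η.mulSmooth _ hχp y = 0 := by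
        filter_upwards [hχx] with y hy
        rw [Test.mulSmooth_apply, hy, mul_zero]
      refine ⟨s₁, 0, fun i j => ?_, Or.inl ⟨rfl, rfl⟩⟩
      have e1 := hloc₁ x i j 1 hη1x
      have e2 := hloc₂ x i j 0 hz
      rw [hv] at e1
      rw [hadd]
      refine (congrArg₂ (· + ·) e1 e2).trans ?_
      ring
    · have ho : ∀ᶠ y in 𝓝 x, η.mulSmooth _ hχp y = 1 := by
        filter_upwards [hχx, hη1x] with y hy hy'
        rw [Test.mulSmooth_apply, hy, hy', mul_one]
      have hh : ∀ i j, partialD j (partialD i (φ₁ + φ₂ : Test)) x =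
          t₁ * (p i * p j) + w₂'' (linForm q x) * (q i * q j) := by
        intro i j
        have e1 := hloc₁ x i j 1 hη1x
        have e2 := hloc₂ x i j 1 ho
        rw [hv] at e1
        rw [hadd]
        refine (congrArg₂ (· + ·) e1 e2).trans ?_
        ring
      refine ⟨t₁, w₂'' (linForm q x), hh, Or.inr ?_⟩
      rcases hval₂ x hx.2.2 with ⟨h, -⟩ | ⟨h, -⟩
      · exact Or.inl ⟨rfl, h⟩
      · exact Or.inr ⟨rfl, h⟩

/-! ### The relaxed energy in diagonal form -/

/-- The relaxation of `F_λ` at a matrix with eigenvalues `a` and `b`. -/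
def relaxed (lam a b : ℝ) : ℝ :=
  if |a| + |b| ≤ √lam then 2 * √lam * (|a| + |b|) - 2 * |a * b| else a ^ 2 + b ^ 2 + lam

theorem exists_sign (a : ℝ) : ∃ σ : ℝ, σ ^ 2 = 1 ∧ σ * a = |a| := by
  rcases le_total 0 a with h | h
  · exact ⟨1, by norm_num, by rw [abs_of_nonneg h, one_mul]⟩
  · exact ⟨-1, by norm_num, by rw [abs_of_nonpos h, neg_one_mul]⟩

/-- As a function of `m` the minorant contains `2 m (|a| + |b|) - m²`; this `m` maximises it subject
to `m ≥ √λ`. -/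
theorem minorant_diagonal {lam a b σ τ : ℝ} (hlam : 0 ≤ lam) (hσ : σ * a = |a|) (hτ : τ * b = |b|) :
    minorant lam (max (|a| + |b|) √lam) σ τ (Matrix.diagonal ![a, b]) = relaxed lam a b := by
  have hdet : σ * τ * (a * b) = |a * b| := by rw [abs_mul, ← hσ, ← hτ]; ring
  simp only [minorant, relaxed, Matrix.det_diagonal, Fin.prod_univ_two]
  simp only [Matrix.diagonal_apply_eq, Matrix.cons_val_zero, Matrix.cons_val_one]
  rw [hσ, hτ, mul_assoc 2 (σ * τ), hdet]
  split_ifs with h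
  · rw [max_eq_right h, Real.sq_sqrt hlam]
    ring
  · rw [max_eq_left (not_le.1 h).le, abs_mul]
    nlinarith [sq_abs a, sq_abs b]

theorem relaxed_le_integral {lam a b : ℝ} (hlam : 0 ≤ lam) {N ξ : Mat} (hξ : ξ 0 1 = ξ 1 0)
    (hN : N * ξ * N.transpose = Matrix.diagonal ![a, b]) {φ : Plane → ℝ}
    {G : Fin 2 → Plane → ℝ} {H : Plane → Mat} (h : IsW2InftyZero φ G H) :
    relaxed lam a b ≤ ∫ x in square, bigF lam (N * (ξ + H x) * N.transpose) := by
  obtain ⟨σ, hσ, hσa⟩ := exists_sign a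
  obtain ⟨τ, hτ, hτb⟩ := exists_sign b
  rw [← minorant_diagonal hlam hσa hτb, ← hN]
  exact minorant_le_integral hlam (le_max_right _ _) hσ hτ N hξ h

theorem exists_abs_entries_bound {f : Mat → ℝ} (hf : Continuous f) (C : ℝ) :
    ∃ D : ℝ, 0 ≤ D ∧ ∀ X : Mat, (∀ i j, |X i j| ≤ C) → f X ≤ D := by
  have hK : IsCompact (Set.univ.pi fun _ : Fin 2 => Set.univ.pi fun _ : Fin 2 => Set.Icc (-C) C) :=
    isCompact_univ_pi fun _ => isCompact_univ_pi fun _ => isCompact_Icc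
  obtain ⟨D, hD⟩ := (hK.image (f := fun X => f (Matrix.of X)) hf).bddAbove
  refine ⟨max D 0, le_max_right _ _, fun X hX => (hD ⟨X, ?_, rfl⟩).trans (le_max_left _ _)⟩
  exact fun i _ j _ => abs_le.1 (hX i j)

theorem exists_integral_le {lam a b : ℝ} (hlam : 0 < lam) {N ξ : Mat} (hdet : IsUnit N.det)
    (hN : N * ξ * N.transpose = Matrix.diagonal ![a, b]) {ε : ℝ} (hε : 0 < ε) :
    ∃ φ G H, IsW2InftyZero φ G H ∧
      ∫ x in square, bigF lam (N * (ξ + H x) * N.transpose) ≤ relaxed lam a b + ε := by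
  have hr : 0 < √lam := Real.sqrt_pos.2 hlam
  by_cases hab : |a| + |b| ≤ √lam
  swap
  · refine ⟨_, _, _, Test.isW2InftyZero 0, ?_⟩
    have hne : N * ξ * N.transpose ≠ 0 := by
      intro h0
      rw [hN] at h0
      have h1 := congrFun (congrFun h0 0) 0
      have h2 := congrFun (congrFun h0 1) 1
      simp at h1 h2
      simp [h1, h2] at hab
    have hz : ∀ x, (Matrix.of fun i j => partialD j (partialD i (0 : Test)) x : Mat) = 0 := by
      intro x
      have h0 : ((0 : Test) : Plane → ℝ) = fun _ => 0 := rfl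
      have h1 : ∀ i, partialD i (fun _ : Plane => (0 : ℝ)) = fun _ => 0 := fun i => by
        funext y
        simp [partialD]
      ext i j
      simp [h0, h1]
    simp only [hz, add_zero, integral_const, smul_eq_mul]
    rw [bigF, if_neg hne, hN, frobSq_eq, relaxed, if_neg hab]
    simp
    linarith
  -- With `r = √λ`, `diag(a, b)` is split along the first axis into `diag(σ(r - |b|), b)` and
  -- `diag(0, b)`, and the latter along the second axis into `0` and `diag(0, τ r)`. `h₁` and `h₂`
  -- say that the increments have opposite signs.
  obtain ⟨σ, hσ, hσa⟩ := exists_sign a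
  obtain ⟨τ, hτ, hτb⟩ := exists_sign b
  have hmd := minorant_diagonal hlam.le hσa hτb
  rw [max_eq_right hab] at hmd
  set r := √lam with hrdef
  have hσ' : σ * σ = 1 := by rw [← pow_two, hσ]
  have hτ' : τ * τ = 1 := by rw [← pow_two, hτ]
  -- the phases of the laminate
  have h₁ : (σ * (r - |b|) - a) * (-a) ≤ 0 := by
    have : (σ * (r - |b|) - a) * (-a) = -(|a| * (r - |b| - |a|)) := by
      linear_combination (-(r - |b|)) * hσa - sq_abs a
    rw [this]
    have := mul_nonneg (abs_nonneg a) (by linarith : 0 ≤ r - |b| - |a|)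
    linarith
  have h₂ : (-b) * (τ * r - b) ≤ 0 := by
    have : (-b) * (τ * r - b) = -(|b| * (r - |b|)) := by
      linear_combination (-r) * hτb - sq_abs b
    rw [this]
    have := mul_nonneg (abs_nonneg b) (by linarith [abs_nonneg a] : 0 ≤ r - |b|)
    linarith
  -- The columns of `N⁻¹` are the lamination directions: the congruence by `N` turns their tensor
  -- squares into the diagonal matrix units.
  set P := N⁻¹ with hP
  have hPN : N * P = 1 := Matrix.mul_nonsing_inv N hdet
  have hcol : ∀ k : Fin 2, (fun i => P i k) ≠ 0 := by
    intro k hk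
    have h1 := congrFun (congrFun hPN k) k
    rw [Matrix.mul_apply] at h1
    have : ∀ i, P i k = 0 := fun i => congrFun hk i
    simp [this] at h1
  have hdiag : ∀ α β : ℝ, N * (ξ + Matrix.of fun i j => α * (P i 0 * P j 0) + β * (P i 1 * P j 1)) *
      N.transpose = Matrix.diagonal ![a + α, b + β] := by
    intro α β
    have e : (Matrix.of fun i j => α * (P i 0 * P j 0) + β * (P i 1 * P j 1) : Mat) =
        P * Matrix.diagonal ![α, β] * P.transpose := by
      ext i j
      simp [Matrix.mul_apply, Fin.sum_univ_two, Matrix.diagonal]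
      ring
    have e2 : N * (P * Matrix.diagonal ![α, β] * P.transpose) * N.transpose =
        (N * P) * Matrix.diagonal ![α, β] * (N * P).transpose := by
      rw [Matrix.transpose_mul]
      simp only [Matrix.mul_assoc]
    rw [e, Matrix.mul_add, Matrix.add_mul, hN, e2, hPN, Matrix.transpose_one, Matrix.one_mul,
      Matrix.mul_one, Matrix.diagonal_add]
    congr 1
    funext i
    fin_cases i <;> rfl
  -- the integrand agrees with the minorant on the phases
  have hphase : ∀ α β : ℝ, ((α = σ * (r - |b|) - a ∧ β = 0) ∨ (α = -a ∧ β = -b) ∨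
      (α = -a ∧ β = τ * r - b)) → bigF lam (Matrix.diagonal ![a + α, b + β]) =
      minorant lam r σ τ (Matrix.diagonal ![a + α, b + β]) := by
    have hgen : ∀ x y, σ * x + τ * y = r → bigF lam (Matrix.diagonal ![x, y]) =
        minorant lam r σ τ (Matrix.diagonal ![x, y]) := by
      intro x y hxy
      refine bigF_diagonal_eq_minorant hσ hτ ?_ hxy
      by_contra hcon
      rw [not_or, not_not, not_not] at hcon
      rw [hcon.1, hcon.2] at hxy
      linarith
    rintro α β (⟨rfl, rfl⟩ | ⟨rfl, rfl⟩ | ⟨rfl, rfl⟩)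
    · apply hgen
      linear_combination (r - |b|) * hσ' + hτb
    · have : (Matrix.diagonal ![a + -a, b + -b] : Mat) = 0 := by
        ext i j
        fin_cases i <;> fin_cases j <;> simp
      rw [this]
      exact bigF_zero_eq_minorant hlam.le
    · apply hgen
      linear_combination r * hτ'
  -- The final `2` absorbs the error `2 * κ`, as `κ ≤ 1`. So `C` and `D` do not depend on `κ`, which
  -- can then be chosen to make the cost `3 * κ * D` of the bad set at most `ε`.
  let C : ℝ := ∑ i, ∑ j, ((|σ * (r - |b|) - a| + |-a|) * |P i 0 * P j 0| +
    (|-b| + |τ * r - b|) * |P i 1 * P j 1|) + 2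
  obtain ⟨D, hD0, hD⟩ := exists_abs_entries_bound (f := fun X => frobSq (N * (ξ + X) * N.transpose)
    + lam - minorant lam r σ τ (N * (ξ + X) * N.transpose)) (by
      have h1 : Continuous fun X : Mat => N * (ξ + X) * N.transpose := by fun_prop
      exact ((continuous_frobSq.comp h1).add_const lam).sub
        ((continuous_minorant lam r σ τ).comp h1)) C
  set κ := min 1 (ε / (3 * (D + 1))) with hκdef
  have hκ : 0 < κ := lt_min one_pos (by positivity)
  obtain ⟨φ, B, hB, hBκ, hbound, hval⟩ := exists_second_order_laminate (hcol 0) (hcol 1) h₁ h₂ hκ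
  have hadm := φ.isW2InftyZero
  refine ⟨_, _, _, hadm, ?_⟩
  set H : Plane → Mat := fun x => Matrix.of fun i j => partialD j (partialD i φ) x with hH
  obtain ⟨hmi, hme⟩ := integral_minorant lam r σ τ N ξ hadm
  have hFi := integrable_bigF hlam.le (ξ := ξ) (N := N) hadm.1.bounded_hess
  rw [hN, hmd] at hme
  have hHC : ∀ x i j, |H x i j| ≤ C := by
    intro x i j
    refine (hbound x i j).trans ?_
    have hnn : ∀ i j, 0 ≤ (|σ * (r - |b|) - a| + |-a|) * |P i 0 * P j 0| +
      (|-b| + |τ * r - b|) * |P i 1 * P j 1| := fun i j => by positivity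
    have h1 := Finset.single_le_sum (f := fun j => (|σ * (r - |b|) - a| + |-a|) * |P i 0 * P j 0| +
      (|-b| + |τ * r - b|) * |P i 1 * P j 1|) (fun j _ => hnn i j) (Finset.mem_univ j)
    have h2 := Finset.single_le_sum (f := fun i => ∑ j, ((|σ * (r - |b|) - a| + |-a|) *
      |P i 0 * P j 0| + (|-b| + |τ * r - b|) * |P i 1 * P j 1|))
      (fun i _ => Finset.sum_nonneg fun j _ => hnn i j) (Finset.mem_univ i)
    have h3 : κ ≤ 1 := min_le_left _ _
    change _ ≤ ∑ i, ∑ j, _ + 2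
    linarith
  have hpt : ∀ x, bigF lam (N * (ξ + H x) * N.transpose) ≤
      minorant lam r σ τ (N * (ξ + H x) * N.transpose) + B.indicator (fun _ => D) x := by
    intro x
    by_cases hx : x ∈ B
    · rw [Set.indicator_of_mem hx]
      have h1 := hD (H x) (hHC x)
      have h2 := bigF_le hlam.le (N * (ξ + H x) * N.transpose)
      linarith
    · obtain ⟨α, β, hαβ, hph⟩ := hval x hx
      have hHx : H x = Matrix.of fun i j => α * (P i 0 * P j 0) + β * (P i 1 * P j 1) := by
        ext i j
        exact hαβ i j
      rw [Set.indicator_of_notMem hx, add_zero, hHx, hdiag]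
      exact (hphase α β hph).le
  have hind : Integrable (B.indicator fun _ => D) (volume.restrict square) :=
    (integrable_const D).indicator hB
  calc ∫ x in square, bigF lam (N * (ξ + H x) * N.transpose)
      ≤ ∫ x in square, (minorant lam r σ τ (N * (ξ + H x) * N.transpose) +
          B.indicator (fun _ => D) x) := integral_mono hFi (hmi.add hind) hpt
    _ = relaxed lam a b + (volume.restrict square).real B * D := by
        rw [integral_add hmi hind, hme, integral_indicator_const D hB, smul_eq_mul]
    _ ≤ relaxed lam a b + ε := by
        have h1 : (volume.restrict square).real B ≤ 3 * κ :=
          ENNReal.toReal_le_of_le_ofReal (by positivity) hBκ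
        have h2 : 3 * κ * D ≤ ε := by
          have h3 : κ ≤ ε / (3 * (D + 1)) := min_le_right _ _
          rw [le_div_iff₀ (by positivity)] at h3
          nlinarith
        have h4 := mul_le_mul_of_nonneg_right h1 hD0
        linarith

/-! ### Diagonalization of the shape operator -/

theorem posDef_metric (v : Plane) : (metric v).PosDef := by
  have h : (metric v) = 1 + Matrix.vecMulVec (v : Fin 2 → ℝ) (star (v : Fin 2 → ℝ)) := by
    ext i j
    simp [metric, Matrix.vecMulVec_apply]
  rw [h]
  exact Matrix.PosDef.one.add_posSemidef (Matrix.posSemidef_vecMulVec_self_star _)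

theorem isUnit_metricInvSqrt (v : Plane) : IsUnit (metricInvSqrt v) := by
  have hspec : ∀ t ∈ spectrum ℝ (metric v), 0 < t := by
    intro t ht
    rw [(posDef_metric v).isHermitian.spectrum_real_eq_range_eigenvalues] at ht
    obtain ⟨i, rfl⟩ := ht
    exact (posDef_metric v).eigenvalues_pos i
  have hcont : ContinuousOn (fun t : ℝ => t ^ (-(1 / 2) : ℝ)) (spectrum ℝ (metric v)) :=
    fun t ht => (Real.continuousAt_rpow_const t _ (Or.inl (hspec t ht).ne')).continuousWithinAt
  have hsa : IsSelfAdjoint (metric v) := (posDef_metric v).isHermitian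
  exact (isUnit_cfc_iff _ _ hcont hsa).2 fun t ht => (Real.rpow_pos_of_pos (hspec t ht) _).ne'

theorem transpose_metricInvSqrt (v : Plane) : (metricInvSqrt v).transpose = metricInvSqrt v := by
  have h : IsSelfAdjoint (metricInvSqrt v) := cfc_predicate _ _
  rw [← Matrix.conjTranspose_eq_transpose_of_trivial]
  exact h

theorem frobSq_eq_trace (A : Mat) : frobSq A = (A.transpose * A).trace := by
  simp [frobSq, Matrix.trace, Matrix.mul_apply, Fin.sum_univ_two]
  ring

theorem frobSq_conj {U : Mat} (hU : U * U.transpose = 1) (A : Mat) :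
    frobSq (U.transpose * A * U) = frobSq A := by
  rw [frobSq_eq_trace, frobSq_eq_trace]
  have : (U.transpose * A * U).transpose * (U.transpose * A * U) =
      U.transpose * (A.transpose * A * U) := by
    simp only [Matrix.transpose_mul, Matrix.transpose_transpose, Matrix.mul_assoc]
    rw [← Matrix.mul_assoc U, hU, Matrix.one_mul]
  rw [this, Matrix.trace_mul_comm, Matrix.mul_assoc, hU, Matrix.mul_one]

theorem bigF_conj (lam : ℝ) {U : Mat} (hU : U * U.transpose = 1) (A : Mat) :
    bigF lam (U.transpose * A * U) = bigF lam A := by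
  simp only [bigF, ← frobSq_eq_zero_iff, frobSq_conj hU]

/-- After a linear change of variables the shape operator is diagonal at `ξ`, and the energy
density is unchanged. -/
theorem exists_congr_diagonal (lam : ℝ) (v : Plane) {ξ : Mat} (hξ : ξ.IsSymm) :
    ∃ (N : Mat) (a b : ℝ), IsUnit N.det ∧ N * ξ * N.transpose = Matrix.diagonal ![a, b] ∧
      (∀ X, bigF lam (shape v X) = bigF lam (N * X * N.transpose)) ∧
      rho (shape v ξ) (shape_isHermitian v hξ) = |a| + |b| ∧ (shape v ξ).det = a * b ∧
      frobSq (shape v ξ) = a ^ 2 + b ^ 2 := by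
  set hA := shape_isHermitian v hξ
  set U : Mat := (hA.eigenvectorUnitary : Mat) with hUdef
  have hUU : U * U.transpose = 1 := by
    have h := Unitary.coe_mul_star_self hA.eigenvectorUnitary
    rwa [Unitary.coe_star, Matrix.star_eq_conjTranspose, Matrix.conjTranspose_eq_transpose_of_trivial] at h
  have hUU' : U.transpose * U = 1 := mul_eq_one_comm.1 hUU
  set c := 1 / √(1 + ‖v‖ ^ 2) with hc
  have hc0 : 0 < c := by positivity
  -- The scalar `c` of the second form is shared by the two factors `N` and `Nᵀ`; the rotation `U`
  -- leaves `F_λ` unchanged.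
  let N : Mat := √c • (U.transpose * metricInvSqrt v)
  have hNX : ∀ X, N * X * N.transpose = U.transpose * shape v X * U := by
    intro X
    simp only [N, shape, secondForm, Matrix.transpose_smul, Matrix.transpose_mul,
      Matrix.transpose_transpose, transpose_metricInvSqrt, Matrix.smul_mul, Matrix.mul_smul,
      smul_smul, Real.mul_self_sqrt hc0.le, Matrix.mul_assoc, ← hc]
  have hdiag : U.transpose * shape v ξ * U =
      Matrix.diagonal ![hA.eigenvalues 0, hA.eigenvalues 1] := by
    have hs : shape v ξ = U * Matrix.diagonal ![hA.eigenvalues 0, hA.eigenvalues 1] *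
        U.transpose := by
      have h := hA.spectral_theorem
      rw [Unitary.conjStarAlgAut_apply, Matrix.star_eq_conjTranspose,
        Matrix.conjTranspose_eq_transpose_of_trivial] at h
      have he : (RCLike.ofReal ∘ hA.eigenvalues : Fin 2 → ℝ) =
          ![hA.eigenvalues 0, hA.eigenvalues 1] := by
        funext i
        fin_cases i <;> rfl
      rwa [he] at h
    refine (congrArg (fun S => U.transpose * S * U) hs).trans ?_
    rw [Matrix.mul_assoc U, ← Matrix.mul_assoc U.transpose, hUU', Matrix.one_mul,
      Matrix.mul_assoc, hUU', Matrix.mul_one]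
  refine ⟨N, hA.eigenvalues 0, hA.eigenvalues 1, ?_, ?_, ?_, ?_, ?_, ?_⟩
  · have hP : (metricInvSqrt v).det ≠ 0 :=
      ((Matrix.isUnit_iff_isUnit_det _).1 (isUnit_metricInvSqrt v)).ne_zero
    have hUd : U.det ≠ 0 := by
      intro h
      have := congrArg Matrix.det hUU
      simp [h] at this
    rw [isUnit_iff_ne_zero]
    simp only [N, Matrix.det_smul, Matrix.det_mul, Matrix.det_transpose]
    have := (Real.sqrt_pos.2 hc0).ne'
    positivity
  · rw [hNX, hdiag]
  · intro X
    rw [hNX, bigF_conj lam hUU]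
  · simp [rho, Fin.sum_univ_two]
  · rw [hA.det_eq_prod_eigenvalues]
    simp [Fin.prod_univ_two]
  · rw [← frobSq_conj hUU, hdiag, frobSq_eq]
    simp

end WillmoreGraph

end

/-! ### The formula for the quasiconvexification. -/

theorem proposition3p1 (lam : ℝ) (hlam : 0 < lam) (v : WillmoreGraph.Plane)
    (ξ : WillmoreGraph.Mat) (hξ : ξ.IsSymm) :
    -- the integrals in the definition of the quasiconvexification exist
    (∀ φ G H, WillmoreGraph.IsW2InftyZero φ G H →
      IntegrableOn (fun x => WillmoreGraph.integrand lam v (ξ + H x)) WillmoreGraph.square) ∧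
    WillmoreGraph.quasiconvexification (WillmoreGraph.integrand lam v) ξ =
      ((√(1 + ‖v‖ ^ 2) *
        (if WillmoreGraph.rho (WillmoreGraph.shape v ξ) (WillmoreGraph.shape_isHermitian v hξ) ≤ √lam
        then 2 * WillmoreGraph.rho (WillmoreGraph.shape v ξ) (WillmoreGraph.shape_isHermitian v hξ)
            - 2 * (|(WillmoreGraph.shape v ξ).det| / √lam)
        else WillmoreGraph.frobSq (WillmoreGraph.shape v ξ) / √lam + √lam) : ℝ) : EReal) := by
  obtain ⟨N, a, b, hN, hNξ, hF, hrho, hdet, hfrob⟩ :=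
    WillmoreGraph.exists_congr_diagonal lam v hξ
  rw [hrho, hdet, hfrob]
  have hr : 0 < √lam := Real.sqrt_pos.2 hlam
  have hpow : lam ^ (-(1 / 2) : ℝ) = 1 / √lam := by
    rw [Real.rpow_neg hlam.le, ← Real.sqrt_eq_rpow, one_div]
  set k := 1 / √lam * √(1 + ‖v‖ ^ 2) with hk
  have hk0 : 0 < k := by positivity
  have hint : ∀ X, WillmoreGraph.integrand lam v X =
      k * WillmoreGraph.bigF lam (N * X * N.transpose) := by
    intro X
    rw [WillmoreGraph.integrand, hF, hpow, hk]
    ring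
  have hval : √(1 + ‖v‖ ^ 2) * (if |a| + |b| ≤ √lam then 2 * (|a| + |b|) - 2 * (|a * b| / √lam)
      else (a ^ 2 + b ^ 2) / √lam + √lam) = k * WillmoreGraph.relaxed lam a b := by
    rw [hk, WillmoreGraph.relaxed]
    split_ifs
    · field_simp
    · field_simp
      rw [Real.sq_sqrt hlam.le]
  have hsymm : ξ 0 1 = ξ 1 0 := hξ.apply 1 0
  rw [hval]
  simp only [WillmoreGraph.quasiconvexification, hint]
  refine ⟨fun φ G H h => (WillmoreGraph.integrable_bigF hlam.le h.1.bounded_hess).const_mul k,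
    le_antisymm ?_ ?_⟩
  · rw [← EReal.le_of_forall_lt_iff_le]
    intro z hz
    have hz' : k * WillmoreGraph.relaxed lam a b < z := EReal.coe_lt_coe_iff.1 hz
    -- The tolerance is `(z - k * relaxed) / k`, so that multiplying by `k` gives exactly `z`.
    obtain ⟨φ, G, H, h, hle⟩ := WillmoreGraph.exists_integral_le hlam hN hNξ
      (div_pos (sub_pos.2 hz') hk0)
    refine iInf_le_of_le φ (iInf_le_of_le G (iInf_le_of_le H (iInf_le_of_le h ?_)))
    rw [EReal.coe_le_coe_iff, integral_const_mul]
    refine (mul_le_mul_of_nonneg_left hle hk0.le).trans (le_of_eq ?_)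
    field_simp
    ring
  · refine le_iInf fun φ => le_iInf fun G => le_iInf fun H => le_iInf fun h => ?_
    rw [EReal.coe_le_coe_iff, integral_const_mul]
    exact mul_le_mul_of_nonneg_left (WillmoreGraph.relaxed_le_integral hlam.le hsymm hNξ h) hk0.le
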